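/- Let $E$ be a complex Banach lattice, i.e. the complexification $E=E_{\mathbb R}+iE_{\mathbb R}$ of a real Banach lattice $E_{\mathbb R}$, with modulus $|z|=\sup_{\theta\in\mathbb R}\operatorname{Re}(e^{i\theta}z)$, norm $\|z\|=\|\,|z|\,\|$ and positive cone $E_+=(E_{\mathbb R})_+$; write $f>0$ for $0\ne f\in E_+$. For $u\in E_+$ let $E_u=\{f\in E:\ |f|\le cu \text{ for some } c\ge 0\}$; $u$ is a quasi-interior point if $E_u$ is dense in $E$. Write $f\gg_u 0$ if $f\ge cu$ for some $c>0$, and $f\ll_u 0$ if $-f\gg_u0$. For a bounded linear operator $T$ on $E$, write $T\gg_u0$ if $Tf\gg_u0$ for all $f>0$; $T$ is called individually eventually strongly positive with respect to $u$ if for every $f>0$ there is $n_0\in\mathbb N$ with $T^nf\gg_u0$ for all $n\ge n_0$. For a linear operator $A:D(A)\subseteq E\to E$ let $\sigma(A)$ and $\rho(A)$ be its spectrum and resolvent set, $R(\lambda,A)=(\lambda-A)^{-1}$ for $\lambda\in\rho(A)$, and $s(A)=\sup\{\operatorname{Re}\lambda:\lambda\in\sigma(A)\}\in[-\infty,\infty]$.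 The operator $A$ is called real if $D(A)=(D(A)\cap E_{\mathbb R})+i(D(A)\cap E_{\mathbb R})$ and $A(D(A)\cap E_{\mathbb R})\subseteq E_{\mathbb R}$. For $\lambda_0\in\sigma(A)\cap\mathbb R$, the resolvent $R(\cdot,A)$ is called individually eventually strongly positive with respect to $u$ at $\lambda_0$ if there is $\lambda_2>\lambda_0$ such that $(\lambda_0,\lambda_2]\subseteq\rho(A)$ and for each $f>0$ there is $\lambda_1\in(\lambda_0,\lambda_2]$ with $R(\lambda,A)f\gg_u0$ for all $\lambda\in(\lambda_0,\lambda_1]$. It is called individually eventually strongly negative with respect to $u$ at $\lambda_0$ if there is $\lambda_2<\lambda_0$ such that $[\lambda_2,\lambda_0)\subseteq\rho(A)$ and for each $f>0$ there is $\lambda_1\in[\lambda_2,\lambda_0)$ with $R(\lambda,A)f\ll_u0$ for all $\lambda\in[\lambda_1,\lambda_0)$. **Theorem.** Let $A$ be a closed, densely defined and real operator on a complex Banach lattice $E$. Suppose that $\lambda_0\in\mathbb R$ is an eigenvalue of $A$ and a pole of the resolvent $R(\cdot,A)$, and let $P=\frac1{2\pi i}\oint R(z,A)\,dz$ (the integral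 being over a small positively oriented circle around $\lambda_0$) be the corresponding spectral projection. Let $0\le u\in E$ be such that $D(A)\subseteq E_u$. Then $u$ is a quasi-interior point of $E_+$, and the following assertions are equivalent: (i) $P\gg_u0$. (ii) The resolvent $R(\cdot,A)$ is individually eventually strongly positive with respect to $u$ at $\lambda_0$. (iii) The resolvent $R(\cdot,A)$ is individually eventually strongly negative with respect to $u$ at $\lambda_0$. If $\lambda_0=s(A)$, then (i)–(iii) are also equivalent to each of the following assertions: (iv) There exists a real $\lambda>s(A)$ such that $R(\lambda,A)$ is individually eventually strongly positive with respect to $u$. (v) For every real $\lambda>s(A)$ the operator $R(\lambda,A)$ is individually eventually strongly positive with respect to $u$. -/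

import Mathlib

open scoped Topology

set_option linter.unusedSectionVars false

/-! ### The complexification of a real Banach lattice -/

/-- The complexification `X + iX` of a real vector space `X`. -/
@[ext]
structure Complexification (X : Type*) where
  re : X
  im : X

namespace Complexification

section Algebra

variable {X : Type*} [AddCommGroup X]

instance : Zero (Complexification X) := ⟨⟨0, 0⟩⟩
instance : Add (Complexification X) := ⟨fun z w => ⟨z.re + w.re, z.im + w.im⟩⟩
instance : Neg (Complexification X) := ⟨fun z => ⟨-z.re, -z.im⟩⟩
instance : Sub (Complexification X) := ⟨fun z w => ⟨z.re - w.re, z.im - w.im⟩⟩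

@[simp] theorem zero_re : (0 : Complexification X).re = 0 := rfl
@[simp] theorem zero_im : (0 : Complexification X).im = 0 := rfl
@[simp] theorem add_re (z w : Complexification X) : (z + w).re = z.re + w.re := rfl
@[simp] theorem add_im (z w : Complexification X) : (z + w).im = z.im + w.im := rfl
@[simp] theorem neg_re (z : Complexification X) : (-z).re = -z.re := rfl
@[simp] theorem neg_im (z : Complexification X) : (-z).im = -z.im := rfl
@[simp] theorem sub_re (z w : Complexification X) : (z - w).re = z.re - w.re := rfl
@[simp] theorem sub_im (z w : Complexification X) : (z - w).im = z.im - w.im := rfl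

instance : AddCommGroup (Complexification X) where
  add_assoc a b c := by ext <;> simp [add_assoc]
  zero_add a := by ext <;> simp
  add_zero a := by ext <;> simp
  add_comm a b := by ext <;> simp [add_comm]
  neg_add_cancel a := by ext <;> simp
  sub_eq_add_neg a b := by ext <;> simp [sub_eq_add_neg]
  nsmul := nsmulRec
  zsmul := zsmulRec

variable [Module ℝ X]

instance : SMul ℂ (Complexification X) :=
  ⟨fun c z => ⟨c.re • z.re - c.im • z.im, c.re • z.im + c.im • z.re⟩⟩

@[simp] theorem smul_re (c : ℂ) (z : Complexification X) :
    (c • z).re = c.re • z.re - c.im • z.im := rfl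
@[simp] theorem smul_im (c : ℂ) (z : Complexification X) :
    (c • z).im = c.re • z.im + c.im • z.re := rfl

instance : Module ℂ (Complexification X) where
  one_smul a := by ext <;> simp
  mul_smul a b z := by ext <;> simp <;> module
  smul_zero a := by ext <;> simp
  smul_add a z w := by ext <;> simp <;> module
  add_smul a b z := by ext <;> simp <;> module
  zero_smul z := by ext <;> simp

/-- The canonical embedding `X → X + iX`. -/
def ofReal (x : X) : Complexification X := ⟨x, 0⟩

end Algebra

/-- The order of the complexification: `z ≤ w` if and only if `w - z` is a positive element
of the real part `X`. -/
instance {X : Type*} [PartialOrder X] : PartialOrder (Complexification X) where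
  le z w := z.re ≤ w.re ∧ z.im = w.im
  le_refl z := ⟨le_rfl, rfl⟩
  le_trans a b c h k := ⟨h.1.trans k.1, h.2.trans k.2⟩
  le_antisymm a b h k := Complexification.ext (le_antisymm h.1 k.1) h.2

theorem le_def {X : Type*} [PartialOrder X] {z w : Complexification X} :
    z ≤ w ↔ z.re ≤ w.re ∧ z.im = w.im := Iff.rfl

section Norm

variable {X : Type*} [NormedAddCommGroup X] [NormedSpace ℝ X] [Lattice X]

/-- The set of all `Re (e^{iθ} z)`, `θ ∈ ℝ`, whose supremum is the modulus of `z`. -/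
def rotations (z : Complexification X) : Set X :=
  {v | ∃ c : ℂ, ‖c‖ = 1 ∧ v = (c • z).re}

open Classical in
/-- The modulus `|z| = sup_θ Re (e^{iθ} z)`; the supremum exists in every Banach lattice,
see `isLUB_modulus`. -/
noncomputable def modulus (z : Complexification X) : X :=
  if h : ∃ m, IsLUB (rotations z) m then h.choose else 0

variable [IsOrderedAddMonoid X] [IsOrderedModule ℝ X]

theorem smul_le_abs_smul_abs (a : ℝ) (x : X) : a • x ≤ |a| • |x| := by
  rcases le_total 0 a with h | h
  · rw [abs_of_nonneg h]
    exact smul_le_smul_of_nonneg_left (le_abs_self x) h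
  · rw [abs_of_nonpos h, ← neg_smul_neg]
    exact smul_le_smul_of_nonneg_left (neg_le_abs x) (by linarith)

theorem smul_re_le (c : ℂ) (z : Complexification X) :
    (c • z).re ≤ ‖c‖ • (|z.re| + |z.im|) := by
  have h1 := smul_le_abs_smul_abs c.re z.re
  have h2 := smul_le_abs_smul_abs (-c.im) z.im
  have h3 : |c.re| • |z.re| ≤ ‖c‖ • |z.re| :=
    smul_le_smul_of_nonneg_right (Complex.abs_re_le_norm c) (abs_nonneg _)
  have h4 : |(-c.im)| • |z.im| ≤ ‖c‖ • |z.im| := by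
    rw [abs_neg]
    exact smul_le_smul_of_nonneg_right (Complex.abs_im_le_norm c) (abs_nonneg _)
  rw [smul_re, smul_add, sub_eq_add_neg, ← neg_smul]
  exact add_le_add (h1.trans h3) (h2.trans h4)

variable [HasSolidNorm X] [CompleteSpace X]

theorem exists_approx (z : Complexification X) {ε : ℝ} (hε : 0 < ε) :
    ∃ m : X, (∀ b ∈ upperBounds (rotations z), m ≤ b) ∧
      m + ε • (|z.re| + |z.im|) ∈ upperBounds (rotations z) := by
  obtain ⟨t, hts, htf, htc⟩ := (isCompact_sphere (0 : ℂ) 1).finite_cover_balls hε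
  have hne : htf.toFinset.Nonempty := by
    have h1 : (1 : ℂ) ∈ Metric.sphere (0 : ℂ) 1 := by simp
    obtain ⟨d, hd, -⟩ := Set.mem_iUnion₂.1 (htc h1)
    exact ⟨d, htf.mem_toFinset.2 hd⟩
  refine ⟨htf.toFinset.sup' hne fun c => (c • z).re, ?_, ?_⟩
  · intro b hb
    refine Finset.sup'_le _ _ fun c hc => hb ⟨c, ?_, rfl⟩
    simpa using hts (htf.mem_toFinset.1 hc)
  · rintro v ⟨c, hc, rfl⟩
    obtain ⟨d, hd, hcd⟩ := Set.mem_iUnion₂.1 (htc (show c ∈ Metric.sphere (0 : ℂ) 1 by simpa using hc))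
    have h1 : (d • z).re ≤ htf.toFinset.sup' hne fun c => (c • z).re :=
      Finset.le_sup' (fun c : ℂ => (c • z).re) (htf.mem_toFinset.2 hd)
    have h2 := smul_re_le (c - d) z
    have h3 : ‖c - d‖ • (|z.re| + |z.im|) ≤ ε • (|z.re| + |z.im|) :=
      smul_le_smul_of_nonneg_right (by rw [← dist_eq_norm]; exact (Metric.mem_ball.1 hcd).le)
        (by positivity)
    have h4 : (c • z).re = (d • z).re + ((c - d) • z).re := by rw [sub_smul]; simp
    rw [h4]
    exact add_le_add h1 (h2.trans h3)

theorem exists_isLUB_rotations (z : Complexification X) : ∃ m, IsLUB (rotations z) m := by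
  set w := |z.re| + |z.im| with hw
  have hw0 : 0 ≤ w := by positivity
  have hpos : ∀ n : ℕ, (0 : ℝ) < 1 / (n + 1) := fun n => Nat.one_div_pos_of_nat
  choose s hs1 hs2 using fun n : ℕ => exists_approx z (hpos n)
  have hlim : Filter.Tendsto (fun n : ℕ => (1 : ℝ) / (n + 1)) Filter.atTop (𝓝 0) :=
    tendsto_one_div_add_atTop_nhds_zero_nat
  have hcau : CauchySeq s := by
    refine cauchySeq_of_le_tendsto_0 (fun n : ℕ => (1 : ℝ) / (n + 1) * ‖w‖) ?_ ?_
    · intro n m N hn hm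
      rw [dist_eq_norm]
      have key : ∀ n m : ℕ, N ≤ m → s n - s m ≤ (1 / ((N : ℝ) + 1)) • w := fun n m hm => by
        rw [sub_le_iff_le_add']
        refine (hs1 n _ (hs2 m)).trans (add_le_add le_rfl ?_)
        exact smul_le_smul_of_nonneg_right (one_div_le_one_div_of_le (by positivity)
          (by exact_mod_cast Nat.succ_le_succ hm)) hw0
      have habs : |s n - s m| ≤ |(1 / ((N : ℝ) + 1)) • w| := by
        refine le_trans (abs_le'.2 ⟨key n m hm, ?_⟩) (le_abs_self _)
        rw [neg_sub]
        exact key m n hn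
      refine (norm_le_norm_of_abs_le_abs habs).trans ?_
      rw [norm_smul, Real.norm_of_nonneg (hpos N).le]
    · simpa using hlim.mul_const ‖w‖
  obtain ⟨l, hl⟩ := cauchySeq_tendsto_of_complete hcau
  refine ⟨l, fun v hv => ?_, fun b hb => le_of_tendsto' hl fun n => hs1 n b hb⟩
  have h : Filter.Tendsto (fun n : ℕ => s n + ((1 : ℝ) / (n + 1)) • w) Filter.atTop (𝓝 l) := by
    simpa using hl.add (hlim.smul_const w)
  exact ge_of_tendsto' h fun n => hs2 n hv

theorem isLUB_modulus (z : Complexification X) : IsLUB (rotations z) (modulus z) := by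
  unfold modulus
  rw [dif_pos (exists_isLUB_rotations z)]
  exact (exists_isLUB_rotations z).choose_spec

theorem re_smul_le_modulus (z : Complexification X) {c : ℂ} (hc : ‖c‖ = 1) :
    (c • z).re ≤ modulus z := (isLUB_modulus z).1 ⟨c, hc, rfl⟩

theorem abs_re_le_modulus (z : Complexification X) : |z.re| ≤ modulus z :=
  abs_le'.2 ⟨by simpa using re_smul_le_modulus z (c := 1) (by simp),
    by simpa using re_smul_le_modulus z (c := -1) (by simp)⟩

theorem abs_im_le_modulus (z : Complexification X) : |z.im| ≤ modulus z :=
  abs_le'.2 ⟨by simpa using re_smul_le_modulus z (c := -Complex.I) (by simp),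
    by simpa using re_smul_le_modulus z (c := Complex.I) (by simp)⟩

theorem modulus_nonneg (z : Complexification X) : 0 ≤ modulus z :=
  (abs_nonneg _).trans (abs_re_le_modulus z)

theorem modulus_le (z : Complexification X) : modulus z ≤ |z.re| + |z.im| := by
  refine (isLUB_modulus z).2 ?_
  rintro v ⟨c, hc, rfl⟩
  simpa [hc] using smul_re_le c z

theorem modulus_add_le (z w : Complexification X) :
    modulus (z + w) ≤ modulus z + modulus w := by
  refine (isLUB_modulus _).2 ?_
  rintro v ⟨c, hc, rfl⟩
  rw [smul_add, add_re]
  exact add_le_add (re_smul_le_modulus z hc) (re_smul_le_modulus w hc)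

theorem modulus_smul_le (a : ℂ) (z : Complexification X) :
    modulus (a • z) ≤ ‖a‖ • modulus z := by
  refine (isLUB_modulus _).2 ?_
  rintro v ⟨c, hc, rfl⟩
  rcases eq_or_ne a 0 with rfl | ha
  · simp
  have hn : (‖a‖ : ℂ) ≠ 0 := by simpa using ha
  have h : c • a • z = (‖a‖ : ℂ) • ((c * a / ‖a‖) • z) := by
    rw [smul_smul, smul_smul]
    congr 1
    field_simp
  rw [h, smul_re, Complex.ofReal_re, Complex.ofReal_im, zero_smul, sub_zero]
  refine smul_le_smul_of_nonneg_left (re_smul_le_modulus z ?_) (norm_nonneg a)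
  simp [hc, ha]

theorem modulus_smul (a : ℂ) (z : Complexification X) :
    modulus (a • z) = ‖a‖ • modulus z := by
  refine le_antisymm (modulus_smul_le a z) ?_
  rcases eq_or_ne a 0 with rfl | ha
  · simpa using modulus_nonneg (0 : Complexification X)
  have h := modulus_smul_le a⁻¹ (a • z)
  rw [smul_smul, inv_mul_cancel₀ ha, one_smul, norm_inv] at h
  have h2 := smul_le_smul_of_nonneg_left h (norm_nonneg a)
  rwa [smul_smul, mul_inv_cancel₀ (norm_ne_zero_iff.2 ha), one_smul] at h2

/-- The norm of the complexification is `‖z‖ = ‖ |z| ‖`. -/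
noncomputable instance : Norm (Complexification X) := ⟨fun z => ‖modulus z‖⟩

theorem norm_def (z : Complexification X) : ‖z‖ = ‖modulus z‖ := rfl

theorem norm_le_of_le {x y : X} (hx : 0 ≤ x) (h : x ≤ y) : ‖x‖ ≤ ‖y‖ :=
  norm_le_norm_of_abs_le_abs (by rwa [abs_of_nonneg hx, abs_of_nonneg (hx.trans h)])

theorem norm_re_le (z : Complexification X) : ‖z.re‖ ≤ ‖z‖ := by
  rw [norm_def, ← norm_abs_eq_norm z.re]
  exact norm_le_of_le (abs_nonneg _) (abs_re_le_modulus z)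

theorem norm_im_le (z : Complexification X) : ‖z.im‖ ≤ ‖z‖ := by
  rw [norm_def, ← norm_abs_eq_norm z.im]
  exact norm_le_of_le (abs_nonneg _) (abs_im_le_modulus z)

theorem norm_le_add (z : Complexification X) : ‖z‖ ≤ ‖z.re‖ + ‖z.im‖ := by
  rw [norm_def, ← norm_abs_eq_norm z.re, ← norm_abs_eq_norm z.im]
  exact (norm_le_of_le (modulus_nonneg z) (modulus_le z)).trans (norm_add_le _ _)

theorem normCore : NormedSpace.Core ℂ (Complexification X) where
  norm_nonneg z := norm_nonneg (modulus z)
  norm_smul c z := by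
    rw [norm_def, norm_def, modulus_smul, norm_smul, norm_norm]
  norm_triangle z w := by
    rw [norm_def, norm_def, norm_def]
    exact (norm_le_of_le (modulus_nonneg _) (modulus_add_le z w)).trans (norm_add_le _ _)
  norm_eq_zero_iff z := by
    constructor
    · intro h
      ext
      · exact norm_le_zero_iff.1 (h ▸ norm_re_le z)
      · exact norm_le_zero_iff.1 (h ▸ norm_im_le z)
    · rintro rfl
      refine le_antisymm ?_ (norm_nonneg (modulus (0 : Complexification X)))
      simpa using norm_le_add (0 : Complexification X)

noncomputable instance : NormedAddCommGroup (Complexification X) :=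
  NormedAddCommGroup.ofCore normCore

noncomputable instance : NormedSpace ℂ (Complexification X) :=
  NormedSpace.ofCore normCore

theorem cauchySeq_re {s : ℕ → Complexification X} (hs : CauchySeq s) :
    CauchySeq fun n => (s n).re := by
  rw [Metric.cauchySeq_iff] at hs ⊢
  intro ε hε
  obtain ⟨N, hN⟩ := hs ε hε
  refine ⟨N, fun m hm n hn => lt_of_le_of_lt ?_ (hN m hm n hn)⟩
  rw [dist_eq_norm, dist_eq_norm]
  exact norm_re_le (s m - s n)

theorem cauchySeq_im {s : ℕ → Complexification X} (hs : CauchySeq s) :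
    CauchySeq fun n => (s n).im := by
  rw [Metric.cauchySeq_iff] at hs ⊢
  intro ε hε
  obtain ⟨N, hN⟩ := hs ε hε
  refine ⟨N, fun m hm n hn => lt_of_le_of_lt ?_ (hN m hm n hn)⟩
  rw [dist_eq_norm, dist_eq_norm]
  exact norm_im_le (s m - s n)

theorem tendsto_of_re_im {s : ℕ → Complexification X} (z : Complexification X)
    (hre : Filter.Tendsto (fun n => (s n).re) Filter.atTop (𝓝 z.re))
    (him : Filter.Tendsto (fun n => (s n).im) Filter.atTop (𝓝 z.im)) :
    Filter.Tendsto s Filter.atTop (𝓝 z) := by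
  have h := (tendsto_iff_norm_sub_tendsto_zero.1 hre).add
    (tendsto_iff_norm_sub_tendsto_zero.1 him)
  rw [add_zero] at h
  refine tendsto_iff_norm_sub_tendsto_zero.2 ?_
  refine squeeze_zero (fun n => norm_nonneg _) (fun n => ?_) h
  exact norm_le_add (s n - z)

theorem exists_tendsto {s : ℕ → Complexification X} (hs : CauchySeq s) :
    ∃ z, Filter.Tendsto s Filter.atTop (𝓝 z) := by
  obtain ⟨x, hx⟩ := cauchySeq_tendsto_of_complete (cauchySeq_re hs)
  obtain ⟨y, hy⟩ := cauchySeq_tendsto_of_complete (cauchySeq_im hs)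
  exact ⟨⟨x, y⟩, tendsto_of_re_im ⟨x, y⟩ hx hy⟩

instance : CompleteSpace (Complexification X) :=
  Metric.complete_of_cauchySeq_tendsto fun _ hs => exists_tendsto hs

end Norm

end Complexification

/-! ### Resolvents of closed operators on a complex Banach space -/

namespace EventualPositivity

section Resolvent

variable {E : Type*} [NormedAddCommGroup E] [NormedSpace ℂ E]

/-- `R` is a bounded two-sided inverse of `z - A : D(A) → E`. -/
def IsResolventAt (A : E →ₗ.[ℂ] E) (z : ℂ) (R : E →L[ℂ] E) : Prop :=
  (∀ g : E, ∃ f : A.domain, (f : E) = R g ∧ z • (f : E) - A f = g) ∧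
    ∀ f : A.domain, R (z • (f : E) - A f) = f

/-- The resolvent set `ρ(A)`. -/
def resolventSet (A : E →ₗ.[ℂ] E) : Set ℂ := {z | ∃ R : E →L[ℂ] E, IsResolventAt A z R}

/-- The spectrum `σ(A)`. -/
def spectrum (A : E →ₗ.[ℂ] E) : Set ℂ := (resolventSet A)ᶜ

open Classical in
/-- The resolvent `R(z, A) = (z - A)⁻¹` for `z ∈ ρ(A)` (and `0` for `z ∈ σ(A)`). -/
noncomputable def resolvent (A : E →ₗ.[ℂ] E) (z : ℂ) : E →L[ℂ] E :=
  if h : ∃ R : E →L[ℂ] E, IsResolventAt A z R then h.choose else 0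

/-- The spectral bound `s(A) = sup {Re z | z ∈ σ(A)} ∈ [-∞, ∞]`. -/
noncomputable def spectralBound (A : E →ₗ.[ℂ] E) : EReal :=
  sSup ((fun z : ℂ => (z.re : EReal)) '' spectrum A)

/-- `z` is an eigenvalue of `A`. -/
def IsEigenvalue (A : E →ₗ.[ℂ] E) (z : ℂ) : Prop :=
  ∃ f : A.domain, (f : E) ≠ 0 ∧ A f = z • (f : E)

/-- The spectral value `μ` is a pole of the analytic map `ρ(A) → L(E)`, `z ↦ R(z, A)`. -/
def IsPoleOfResolvent (A : E →ₗ.[ℂ] E) (μ : ℂ) : Prop :=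
  μ ∈ spectrum A ∧ (∀ᶠ z in 𝓝[≠] μ, z ∈ resolventSet A) ∧
    MeromorphicAt (resolvent A) μ ∧ meromorphicOrderAt (resolvent A) μ < 0

/-- `P = (2πi)⁻¹ ∮ R(z, A) dz` over a positively oriented circle around `μ` which,
together with its interior except for `μ`, lies in `ρ(A)`: `P` is the spectral projection
associated with the isolated spectral value `μ`. -/
def IsSpectralProjection (A : E →ₗ.[ℂ] E) (μ : ℂ) (P : E →L[ℂ] E) : Prop :=
  ∃ r : ℝ, 0 < r ∧ Metric.closedBall μ r \ {μ} ⊆ resolventSet A ∧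
    P = (2 * Real.pi * Complex.I : ℂ)⁻¹ • ∮ z in C(μ, r), resolvent A z

end Resolvent

/-! ### Strong positivity on complex Banach lattices -/

section Positivity

variable {X : Type*} [NormedAddCommGroup X] [NormedSpace ℝ X] [Lattice X]
  [IsOrderedAddMonoid X] [IsOrderedModule ℝ X] [HasSolidNorm X] [CompleteSpace X]

/-- The principal ideal `E_u = {f | ∃ c ≥ 0, |f| ≤ c u}`. -/
def principalIdeal (u : Complexification X) : Set (Complexification X) :=
  {f | ∃ c : ℝ, 0 ≤ c ∧ Complexification.ofReal (Complexification.modulus f) ≤ c • u}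

/-- `u` is a quasi-interior point of the positive cone. -/
def IsQuasiInterior (u : Complexification X) : Prop :=
  0 ≤ u ∧ Dense (principalIdeal u)

/-- `f ≫_u 0`. -/
def StronglyPos (u f : Complexification X) : Prop := ∃ c : ℝ, 0 < c ∧ c • u ≤ f

/-- `f ≪_u 0`. -/
def StronglyNeg (u f : Complexification X) : Prop := StronglyPos u (-f)

/-- `T ≫_u 0`. -/
def StronglyPosOp (u : Complexification X)
    (T : Complexification X →L[ℂ] Complexification X) : Prop :=
  ∀ f, 0 < f → StronglyPos u (T f)

/-- `A` is real: `D(A) = D(A) ∩ X + i (D(A) ∩ X)` and `A (D(A) ∩ X) ⊆ X`. -/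
def IsRealOperator (A : Complexification X →ₗ.[ℂ] Complexification X) : Prop :=
  (∀ f, f ∈ A.domain ↔ ∃ x y : X, Complexification.ofReal x ∈ A.domain ∧
      Complexification.ofReal y ∈ A.domain ∧
      f = Complexification.ofReal x + Complex.I • Complexification.ofReal y) ∧
    ∀ f : A.domain, (f : Complexification X).im = 0 → (A f).im = 0

/-- The resolvent of `A` is individually eventually strongly positive with respect to `u`
at `l₀`. -/
def ResolventEventuallyStronglyPos (A : Complexification X →ₗ.[ℂ] Complexification X)
    (u : Complexification X) (l₀ : ℝ) : Prop :=
  ∃ l₂ : ℝ, l₀ < l₂ ∧ (∀ l ∈ Set.Ioc l₀ l₂, (l : ℂ) ∈ resolventSet A) ∧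
    ∀ f : Complexification X, 0 < f → ∃ l₁ ∈ Set.Ioc l₀ l₂,
      ∀ l ∈ Set.Ioc l₀ l₁, StronglyPos u (resolvent A (l : ℂ) f)

/-- The resolvent of `A` is individually eventually strongly negative with respect to `u`
at `l₀`. -/
def ResolventEventuallyStronglyNeg (A : Complexification X →ₗ.[ℂ] Complexification X)
    (u : Complexification X) (l₀ : ℝ) : Prop :=
  ∃ l₂ : ℝ, l₂ < l₀ ∧ (∀ l ∈ Set.Ico l₂ l₀, (l : ℂ) ∈ resolventSet A) ∧
    ∀ f : Complexification X, 0 < f → ∃ l₁ ∈ Set.Ico l₂ l₀,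
      ∀ l ∈ Set.Ico l₁ l₀, StronglyNeg u (resolvent A (l : ℂ) f)

/-- The bounded operator `T` is individually eventually strongly positive with respect to
`u`: for every `f > 0`, `T ^ n f ≫_u 0` for all large `n`. -/
def EventuallyStronglyPosOp (u : Complexification X)
    (T : Complexification X →L[ℂ] Complexification X) : Prop :=
  ∀ f, 0 < f → ∃ n₀ : ℕ, ∀ n ≥ n₀, StronglyPos u ((T ^ n) f)

end Positivity

end EventualPositivity

namespace EventualPositivity

open Filter

/-! ### Resolvent identities and analyticity of the resolvent. -/

section ResolventTheory

variable {E : Type*} [NormedAddCommGroup E] [NormedSpace ℂ E] {A : E →ₗ.[ℂ] E}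

/-! Density of the domain inside `E_u` makes `u` quasi-interior. Everything else compares the
resolvent with its Laurent coefficients `Q_k` at `l₀`, where `Q_0 = P`.

From `P` to the resolvent: `P` is a projection with range in `D(A) ⊆ E_u`, so strong positivity
forces rank one (`StronglyPosOp.exists_eq_smul`). The range is then spanned by an eigenvector, which
`Q_1` kills; since `Q_k P = Q_k` (`laurentCoeff_zero_mul`), all `Q_k` with `k ≥ 1` vanish and the
pole is simple. Hence `(t - l₀) R(t)` tends to `P` in norm, and if `l₀ = s(A)`, so do the powers of
`(l - l₀) R(l)` for `l > l₀` (`tendsto_pow_smul_resolvent`). Norm convergence alone gives no lower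
bound by `u`; the gain comes from splitting off one resolvent, which is bounded from `E` into `E_u`
by Baire (`exists_bound_of_range_subset`).

From the resolvent to `P`: let `U` be the leading coefficient. Up to a sign it is a limit of
positive operators; for powers of `R(l)`, positivity of `U` comes from an iterated resolvent
identity whose finitely many uncontrolled terms disappear in the limit. `U` is invariant under `(w -
l₀) R(w)` on both sides. Using invariance on the right and then on the left,
`stronglyPosOp_of_invariant` shows that `U` is strongly positive with `U * U ≠ 0`. A pole of order
at least two would have `U * U = 0`, so the pole is simple and `U = P`. -/

theorem isResolventAt_resolvent {z : ℂ} (hz : z ∈ resolventSet A) :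
    IsResolventAt A z (resolvent A z) := by
  have h : ∃ R : E →L[ℂ] E, IsResolventAt A z R := hz
  rw [resolvent, dif_pos h]
  exact h.choose_spec

theorem resolvent_mem_domain {z : ℂ} (hz : z ∈ resolventSet A) (g : E) :
    resolvent A z g ∈ A.domain := by
  obtain ⟨f, hf, -⟩ := (isResolventAt_resolvent hz).1 g
  exact hf ▸ f.2

/-- `z - A` is a right inverse of `R(z, A)`. -/
theorem sub_apply_resolvent {z : ℂ} (hz : z ∈ resolventSet A) (g : E)
    (h : resolvent A z g ∈ A.domain) :
    z • resolvent A z g - A ⟨resolvent A z g, h⟩ = g := by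
  obtain ⟨f, hf, hg⟩ := (isResolventAt_resolvent hz).1 g
  have : (⟨resolvent A z g, h⟩ : A.domain) = f := Subtype.ext hf.symm
  rw [this, ← hf, hg]

theorem resolvent_sub_apply {z : ℂ} (hz : z ∈ resolventSet A) (f : A.domain) :
    resolvent A z (z • (f : E) - A f) = f :=
  (isResolventAt_resolvent hz).2 f

theorem resolvent_eigenvector {z μ : ℂ} (hz : z ∈ resolventSet A) (f : A.domain)
    (hf : A f = μ • (f : E)) : (z - μ) • resolvent A z (f : E) = f := by
  have h := resolvent_sub_apply hz f
  rwa [hf, ← sub_smul, map_smul] at h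

/-- The resolvent identity. -/
theorem resolvent_identity {z w : ℂ} (hz : z ∈ resolventSet A) (hw : w ∈ resolventSet A) :
    resolvent A z - resolvent A w = (w - z) • (resolvent A z * resolvent A w) := by
  ext g
  have h1 := sub_apply_resolvent hw g (resolvent_mem_domain hw g)
  have h2 := resolvent_sub_apply hz ⟨resolvent A w g, resolvent_mem_domain hw g⟩
  have h3 : z • resolvent A w g - A ⟨resolvent A w g, resolvent_mem_domain hw g⟩ =
      g - (w - z) • resolvent A w g := by
    refine Eq.trans ?_ (congrArg (· - (w - z) • resolvent A w g) h1)
    module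
  rw [h3, map_sub, map_smul] at h2
  simp only [sub_apply, smul_apply, mul_apply_eq_comp]
  rw [sub_eq_iff_eq_add] at h2
  rw [h2]
  abel

theorem resolvent_commute {z w : ℂ} (hz : z ∈ resolventSet A) (hw : w ∈ resolventSet A) :
    resolvent A z * resolvent A w = resolvent A w * resolvent A z := by
  rcases eq_or_ne z w with rfl | hne
  · rfl
  have h1 := resolvent_identity hz hw
  have h2 := resolvent_identity hw hz
  have h3 : (w - z) • (resolvent A z * resolvent A w) =
      (w - z) • (resolvent A w * resolvent A z) := by
    rw [← h1, ← neg_sub z w, neg_smul, ← h2, neg_sub]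
  exact smul_right_injective _ (sub_ne_zero.2 hne.symm) h3

/-- The resolvent identity as a factorization. The left factor is a unit for `z` near `w`, which
yields analyticity; iterating the relation gives the Neumann expansion. -/
theorem one_add_mul_resolvent {z w : ℂ} (hz : z ∈ resolventSet A) (hw : w ∈ resolventSet A) :
    (1 + (z - w) • resolvent A w) * resolvent A z = resolvent A w := by
  have h := resolvent_identity hz hw
  rw [add_mul, one_mul, smul_mul_assoc, resolvent_commute hw hz, ← neg_sub w z, neg_smul, ← h]
  abel

theorem resolvent_mul_one_add {z w : ℂ} (hz : z ∈ resolventSet A) (hw : w ∈ resolventSet A) :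
    resolvent A z * (1 + (z - w) • resolvent A w) = resolvent A w := by
  refine Eq.trans ?_ (one_add_mul_resolvent hz hw)
  rw [mul_add, add_mul, mul_one, one_mul, mul_smul_comm, smul_mul_assoc,
    resolvent_commute hw hz]

/-- Near `z₀` one has `R(z) = (1 + (z - z₀) R(z₀))⁻¹ R(z₀)`, and inversion in a Banach algebra is
differentiable at `1`. Working within the resolvent set avoids having to know that it is open. -/
theorem differentiableOn_resolvent [CompleteSpace E] :
    DifferentiableOn ℂ (resolvent A) (resolventSet A) := by
  intro z₀ h₀
  set T := resolvent A z₀ with hT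
  have hc : Continuous fun z : ℂ => (1 : E →L[ℂ] E) + (z - z₀) • T := by fun_prop
  have h1 : (1 : E →L[ℂ] E) + (z₀ - z₀) • T = 1 := by simp
  have hU : ∀ᶠ z in 𝓝 z₀, IsUnit ((1 : E →L[ℂ] E) + (z - z₀) • T) := by
    refine hc.continuousAt.eventually ?_
    simp only [h1]
    exact Units.isOpen.mem_nhds isUnit_one
  have heq : ∀ᶠ z in 𝓝[resolventSet A] z₀,
      resolvent A z = Ring.inverse ((1 : E →L[ℂ] E) + (z - z₀) • T) * T := by
    filter_upwards [self_mem_nhdsWithin, hU.filter_mono nhdsWithin_le_nhds] with z hz hu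
    have h := one_add_mul_resolvent hz h₀
    rw [← hT] at h
    nth_rw 2 [← h]
    rw [← mul_assoc, Ring.inverse_mul_cancel _ hu, one_mul]
  have hd : DifferentiableAt ℂ (fun z : ℂ => (1 : E →L[ℂ] E) + (z - z₀) • T) z₀ := by fun_prop
  have hinv : DifferentiableAt ℂ
      (fun z : ℂ => Ring.inverse ((1 : E →L[ℂ] E) + (z - z₀) • T) * T) z₀ := by
    refine DifferentiableAt.mul_const ?_ T
    refine DifferentiableAt.comp z₀ (differentiableAt_inverse ?_) hd
    rw [h1]
    exact isUnit_one
  exact hinv.differentiableWithinAt.congr_of_eventuallyEq heq (heq.self_of_nhdsWithin h₀)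

end ResolventTheory

/-! ### Laurent coefficients at a pole -/

section Laurent

variable {E : Type*} [NormedAddCommGroup E] [NormedSpace ℂ E] [CompleteSpace E]
  {F : Type*} [NormedAddCommGroup F] [NormedSpace ℂ F] [CompleteSpace F]

theorem map_circleIntegral (L : E →L[ℂ] F) {f : ℂ → E} {c : ℂ} {r : ℝ}
    (hf : CircleIntegrable f c r) : L (∮ z in C(c, r), f z) = ∮ z in C(c, r), L (f z) := by
  simp only [circleIntegral]
  rw [← ContinuousLinearMap.intervalIntegral_comp_comm L hf.out]
  simp

/-- The coefficient of `(z - μ)⁻¹⁻ᵏ` in the Laurent expansion of the resolvent. -/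
noncomputable def laurentCoeff (A : E →ₗ.[ℂ] E) (μ : ℂ) (r : ℝ) (k : ℕ) : E →L[ℂ] E :=
  (2 * Real.pi * Complex.I : ℂ)⁻¹ • ∮ z in C(μ, r), (z - μ) ^ k • resolvent A z

variable {A : E →ₗ.[ℂ] E} {μ : ℂ} {r : ℝ}

theorem sphere_subset_resolventSet (hr : 0 < r)
    (hball : Metric.closedBall μ r \ {μ} ⊆ resolventSet A) :
    Metric.sphere μ r ⊆ resolventSet A := fun z hz => hball
  ⟨Metric.sphere_subset_closedBall hz, fun h => by
    rw [Set.mem_singleton_iff] at h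
    subst h
    simp at hz
    exact hr.ne hz⟩

theorem circleIntegrable_pow_smul_resolvent (hr : 0 < r)
    (hball : Metric.closedBall μ r \ {μ} ⊆ resolventSet A) (k : ℕ) :
    CircleIntegrable (fun z => (z - μ) ^ k • resolvent A z) μ r := by
  refine ContinuousOn.circleIntegrable hr.le ?_
  refine ContinuousOn.smul (f := fun z : ℂ => (z - μ) ^ k) (by fun_prop) ?_
  exact differentiableOn_resolvent.continuousOn.mono (sphere_subset_resolventSet hr hball)

/-- If `L (R(z, A))` is a given function on the circle, then `L` of the Laurent coefficients is
obtained by integrating it. -/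
theorem map_laurentCoeff (L : (E →L[ℂ] E) →L[ℂ] F) (hr : 0 < r)
    (hball : Metric.closedBall μ r \ {μ} ⊆ resolventSet A) (k : ℕ) :
    L (laurentCoeff A μ r k) =
      (2 * Real.pi * Complex.I : ℂ)⁻¹ • ∮ z in C(μ, r), (z - μ) ^ k • L (resolvent A z) := by
  rw [laurentCoeff, map_smul,
    map_circleIntegral L (circleIntegrable_pow_smul_resolvent hr hball k)]
  simp only [map_smul]

theorem laurentCoeff_commute (hr : 0 < r)
    (hball : Metric.closedBall μ r \ {μ} ⊆ resolventSet A) (k : ℕ) {w : ℂ}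
    (hw : w ∈ resolventSet A) :
    laurentCoeff A μ r k * resolvent A w = resolvent A w * laurentCoeff A μ r k := by
  have h1 := map_laurentCoeff ((ContinuousLinearMap.mul ℂ (E →L[ℂ] E)).flip (resolvent A w))
    hr hball k
  have h2 := map_laurentCoeff (ContinuousLinearMap.mul ℂ (E →L[ℂ] E) (resolvent A w))
    hr hball k
  simp only [ContinuousLinearMap.flip_apply, ContinuousLinearMap.mul_apply'] at h1 h2
  rw [h1, h2]
  congr 1
  refine circleIntegral.integral_congr hr.le fun z hz => ?_
  simp only [resolvent_commute (sphere_subset_resolventSet hr hball hz) hw]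

/-- The recursion satisfied by the Laurent coefficients. -/
theorem laurentCoeff_mul_resolvent (hr : 0 < r)
    (hball : Metric.closedBall μ r \ {μ} ⊆ resolventSet A) (k : ℕ) {w : ℂ}
    (hw : w ∈ resolventSet A) :
    (w - μ) • (laurentCoeff A μ r k * resolvent A w) - laurentCoeff A μ r k =
      laurentCoeff A μ r (k + 1) * resolvent A w := by
  have hs := sphere_subset_resolventSet hr hball
  have h := fun j => map_laurentCoeff
    ((ContinuousLinearMap.mul ℂ (E →L[ℂ] E)).flip (resolvent A w)) hr hball j
  simp only [ContinuousLinearMap.flip_apply, ContinuousLinearMap.mul_apply'] at h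
  have hcont : ∀ j, ContinuousOn (fun z => (z - μ) ^ j • (resolvent A z * resolvent A w))
      (Metric.sphere μ r) := by
    intro j
    refine ContinuousOn.smul (f := fun z : ℂ => (z - μ) ^ j) (by fun_prop) ?_
    exact (differentiableOn_resolvent.continuousOn.mono hs).mul continuousOn_const
  have hint : CircleIntegrable
      (fun z => (w - μ) • (z - μ) ^ k • (resolvent A z * resolvent A w)) μ r :=
    ContinuousOn.circleIntegrable hr.le ((hcont k).const_smul (w - μ))
  -- Under the integral, `(w - z) R(z) R(w) = R(z) - R(w)`; the term with the constant `R(w)` is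
  -- entire in `z` and contributes nothing, wherever `w` lies.
  have h0 : (∮ z in C(μ, r), (z - μ) ^ k • resolvent A w) = 0 := by
    refine Complex.circleIntegral_eq_zero_of_differentiable_on_off_countable hr.le
      Set.countable_empty (Continuous.continuousOn (by fun_prop)) fun z _ => ?_
    fun_prop
  have hint' : CircleIntegrable (fun z => (z - μ) ^ k • resolvent A w) μ r :=
    ContinuousOn.circleIntegrable hr.le (Continuous.continuousOn (by fun_prop))
  have key : (w - μ) • (∮ z in C(μ, r), (z - μ) ^ k • (resolvent A z * resolvent A w)) -
      (∮ z in C(μ, r), (z - μ) ^ (k + 1) • (resolvent A z * resolvent A w)) =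
      (∮ z in C(μ, r), (z - μ) ^ k • resolvent A z) -
        ∮ z in C(μ, r), (z - μ) ^ k • resolvent A w := by
    rw [← circleIntegral.integral_smul, ← circleIntegral.integral_sub
      hint
      (ContinuousOn.circleIntegrable hr.le (hcont (k + 1))),
      ← circleIntegral.integral_sub (circleIntegrable_pow_smul_resolvent hr hball k) hint']
    refine circleIntegral.integral_congr hr.le fun z hz => ?_
    rw [← smul_sub, resolvent_identity (hs hz) hw]
    module
  rw [h0, sub_zero] at key
  rw [h, h, laurentCoeff, ← key]
  module

/-- Cauchy's formula for `G` gives the coefficient of index `m`, and Cauchy's theorem for `(z - μ)^j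
G` kills the later ones. Continuity of `G` at `μ` suffices, as one exceptional point is allowed. -/
theorem laurentCoeff_zero (hr : 0 < r)
    (hball : Metric.closedBall μ r \ {μ} ⊆ resolventSet A) {m : ℕ}
    {G : ℂ → E →L[ℂ] E} (hG : ContinuousAt G μ)
    (heq : ∀ z, z ≠ μ → G z = (z - μ) ^ (m + 1) • resolvent A z) :
    laurentCoeff A μ r m = G μ ∧ ∀ k, m < k → laurentCoeff A μ r k = 0 := by
  have hd : DifferentiableOn ℂ G (Metric.closedBall μ r \ {μ}) := by
    refine DifferentiableOn.congr (f := fun z => (z - μ) ^ (m + 1) • resolvent A z) ?_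
      fun z hz => heq z hz.2
    have h1 : DifferentiableOn ℂ (fun z : ℂ => (z - μ) ^ (m + 1))
        (Metric.closedBall μ r \ {μ}) := by fun_prop
    exact h1.smul (differentiableOn_resolvent.mono hball)
  have hc : ContinuousOn G (Metric.closedBall μ r) := by
    intro z hz
    rcases eq_or_ne z μ with rfl | hne
    · exact hG.continuousWithinAt
    · have h1 := (hd.continuousOn z ⟨hz, hne⟩)
      rw [Set.sdiff_eq] at h1
      exact (continuousWithinAt_inter (isOpen_compl_singleton.mem_nhds hne)).1 h1
  have hda : ∀ z ∈ Metric.ball μ r \ {μ}, DifferentiableAt ℂ G z := by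
    intro z hz
    refine hd.differentiableAt ?_
    refine mem_of_superset ((Metric.isOpen_ball.sdiff isClosed_singleton).mem_nhds hz) ?_
    exact Set.sdiff_subset_sdiff_left Metric.ball_subset_closedBall
  have hne : ∀ z ∈ Metric.sphere μ r, z ≠ μ := by
    rintro z hz rfl
    simp at hz
    exact hr.ne hz
  constructor
  · have h := Complex.circleIntegral_sub_inv_smul_of_differentiable_on_off_countable
      (Set.countable_singleton μ) (Metric.mem_ball_self hr) hc hda
    rw [laurentCoeff, inv_smul_eq_iff₀ Complex.two_pi_I_ne_zero, ← h]
    refine circleIntegral.integral_congr hr.le fun z hz => ?_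
    have hz0 := sub_ne_zero.2 (hne z hz)
    rw [heq z (hne z hz), smul_smul, pow_succ', inv_mul_cancel_left₀ hz0]
  · intro k hk
    obtain ⟨j, rfl⟩ : ∃ j, k = j + (m + 1) := ⟨k - (m + 1), by omega⟩
    have h1 : Differentiable ℂ fun z : ℂ => (z - μ) ^ j := by fun_prop
    have h := Complex.circleIntegral_eq_zero_of_differentiable_on_off_countable
      (f := fun z => (z - μ) ^ j • G z) hr.le
      (Set.countable_singleton μ) (h1.continuous.continuousOn.smul hc) fun z hz =>
        (h1 z).smul (hda z hz)
    rw [laurentCoeff, inv_smul_eq_iff₀ Complex.two_pi_I_ne_zero, smul_zero, ← h]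
    refine circleIntegral.integral_congr hr.le fun z hz => ?_
    rw [heq z (hne z hz), smul_smul, pow_add]

/-- The leading behaviour of the resolvent at a pole of order `m + 1`. -/
theorem IsPoleOfResolvent.exists_leading (h : IsPoleOfResolvent A μ) :
    ∃ (m : ℕ) (U : E →L[ℂ] E), U ≠ 0 ∧
      Tendsto (fun z => (z - μ) ^ (m + 1) • resolvent A z) (𝓝[≠] μ) (𝓝 U) ∧
      (m = 0 → ∃ L : E →L[ℂ] E,
        Tendsto (fun z => resolvent A z - (z - μ)⁻¹ • U) (𝓝[≠] μ) (𝓝 L)) ∧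
      ∀ r, 0 < r → Metric.closedBall μ r \ {μ} ⊆ resolventSet A →
        laurentCoeff A μ r m = U ∧ ∀ k, m < k → laurentCoeff A μ r k = 0 := by
  obtain ⟨-, -, hmer, hord⟩ := h
  obtain ⟨n, hn⟩ := WithTop.ne_top_iff_exists.1 (ne_top_of_lt hord)
  obtain ⟨g, hg, hg0, heq⟩ := (meromorphicOrderAt_eq_int_iff hmer).1 hn.symm
  have hn0 : n < 0 := by
    rw [← hn] at hord
    exact_mod_cast hord
  obtain ⟨m, rfl⟩ : ∃ m : ℕ, n = -((m + 1 : ℕ) : ℤ) := ⟨(-n - 1).toNat, by omega⟩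
  have heq' : ∀ᶠ z in 𝓝[≠] μ, (z - μ) ^ (m + 1) • resolvent A z = g z := by
    filter_upwards [heq, self_mem_nhdsWithin] with z hz hne
    have hne' : z - μ ≠ 0 := sub_ne_zero.2 hne
    rw [hz, zpow_neg, zpow_natCast, smul_inv_smul₀ (pow_ne_zero _ hne')]
  have hlim : Tendsto (fun z => (z - μ) ^ (m + 1) • resolvent A z) (𝓝[≠] μ) (𝓝 (g μ)) :=
    (hg.continuousAt.tendsto.mono_left nhdsWithin_le_nhds).congr' (heq'.mono fun z hz => hz.symm)
  refine ⟨m, g μ, hg0, hlim, ?_, ?_⟩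
  · rintro rfl
    -- For a simple pole, `R(z) - (z - μ)⁻¹ U` is the difference quotient of `g` at `μ`.
    refine ⟨deriv g μ, ?_⟩
    have hs := hasDerivAt_iff_tendsto_slope.1 hg.differentiableAt.hasDerivAt
    refine hs.congr' ?_
    filter_upwards [heq', self_mem_nhdsWithin] with z hz hne
    have hne' : z - μ ≠ 0 := sub_ne_zero.2 hne
    rw [slope_def_module, ← hz, smul_sub, zero_add, pow_one, inv_smul_smul₀ hne']
  · intro r hr hball
    classical
    set G : ℂ → E →L[ℂ] E :=
      Function.update (fun z => (z - μ) ^ (m + 1) • resolvent A z) μ (g μ) with hGdef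
    have hG : ContinuousAt G μ := continuousAt_update_same.2 hlim
    have h := laurentCoeff_zero hr hball hG fun z hz => Function.update_of_ne hz _ _
    rwa [hGdef, Function.update_self] at h

/-- A single contour suffices. Dividing the recursion by powers of `z - μ` expresses `Q_k R(z)`
through `Q_k` and `Q_{k+1} R(z)`; iteration stops because the pole has finite order. The case `k =
0` says that `P` is a projection. -/
theorem laurentCoeff_zero_mul (hr : 0 < r)
    (hball : Metric.closedBall μ r \ {μ} ⊆ resolventSet A) {m : ℕ}
    (hm : ∀ k, m < k → laurentCoeff A μ r k = 0) (k : ℕ) :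
    laurentCoeff A μ r k * laurentCoeff A μ r 0 = laurentCoeff A μ r k := by
  have hs := sphere_subset_resolventSet hr hball
  have hne : ∀ z ∈ Metric.sphere μ r, z ≠ μ := by
    rintro z hz rfl
    simp at hz
    exact hr.ne hz
  have hcont : ∀ (n : ℤ) (f : ℂ → E →L[ℂ] E), ContinuousOn f (Metric.sphere μ r) →
      CircleIntegrable (fun z => (z - μ) ^ n • f z) μ r := by
    intro n f hf
    have h : ContinuousOn (fun z : ℂ => (z - μ) ^ n) (Metric.sphere μ r) :=
      ContinuousOn.zpow₀ (by fun_prop) n fun z hz => Or.inl (sub_ne_zero.2 (hne z hz))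
    exact ContinuousOn.circleIntegrable hr.le (h.smul hf)
  have hR : ContinuousOn (resolvent A) (Metric.sphere μ r) :=
    differentiableOn_resolvent.continuousOn.mono hs
  have hstep : ∀ (k j : ℕ), (∮ z in C(μ, r), (z - μ) ^ (-j : ℤ) •
      (laurentCoeff A μ r k * resolvent A z)) =
      (∮ z in C(μ, r), (z - μ) ^ (-(j + 1 : ℕ) : ℤ)) • laurentCoeff A μ r k +
      ∮ z in C(μ, r), (z - μ) ^ (-(j + 1 : ℕ) : ℤ) •
        (laurentCoeff A μ r (k + 1) * resolvent A z) := by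
    intro k j
    have e := circleIntegral.integral_smul_const (fun z => (z - μ) ^ (-(j + 1 : ℕ) : ℤ))
      (laurentCoeff A μ r k) μ r
    refine Eq.trans ?_ (congrArg (· + _) e)
    rw [← circleIntegral.integral_add
      (hcont _ (fun _ => laurentCoeff A μ r k) continuousOn_const)
      (hcont _ (fun z => laurentCoeff A μ r (k + 1) * resolvent A z)
        (continuousOn_const.mul hR))]
    refine circleIntegral.integral_congr hr.le fun z hz => ?_
    have hz0 := sub_ne_zero.2 (hne z hz)
    have h := laurentCoeff_mul_resolvent hr hball k (hs hz)
    rw [← h, ← smul_add, add_sub_cancel, smul_smul, ← zpow_add_one₀ hz0]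
    congr 2
    push_cast
    ring
  -- Here `n` bounds the steps left before the coefficients vanish, and `j` is the power already
  -- divided out. Only `j = 0` meets the integral of `(z - μ)⁻¹`; all other scalar integrals are
  -- zero.
  have hmain : ∀ (n k : ℕ), m + 1 ≤ k + n → ∀ j : ℕ, (∮ z in C(μ, r), (z - μ) ^ (-j : ℤ) •
      (laurentCoeff A μ r k * resolvent A z)) =
      if j = 0 then (2 * Real.pi * Complex.I : ℂ) • laurentCoeff A μ r k else 0 := by
    intro n
    induction n with
    | zero =>
      intro k hk j
      rw [hm k (by omega)]
      simp [circleIntegral]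
    | succ n ih =>
      intro k hk j
      rw [hstep, ih (k + 1) (by omega) (j + 1), if_neg (Nat.succ_ne_zero j), add_zero]
      rcases Nat.eq_zero_or_pos j with rfl | hj
      · rw [if_pos rfl, ← circleIntegral.integral_sub_center_inv μ hr.ne']
        simp
      · rw [if_neg hj.ne', circleIntegral.integral_sub_zpow_of_ne (by omega), zero_smul]
  have h := map_laurentCoeff
    (ContinuousLinearMap.mul ℂ (E →L[ℂ] E) (laurentCoeff A μ r k)) hr hball 0
  simp only [ContinuousLinearMap.mul_apply'] at h
  have h2 := hmain (m + 1) k (by omega) 0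
  rw [if_pos rfl] at h2
  simp only [pow_zero] at h
  simp only [Nat.cast_zero, neg_zero, zpow_zero] at h2
  rw [h, h2, inv_smul_smul₀ Complex.two_pi_I_ne_zero]

end Laurent
end EventualPositivity

/-! ### Decay of powers from the spectral radius. -/

section Powers

open Filter

/-- The hypothesis puts the spectrum in the open unit disc, so by compactness the spectral radius is
below `1`; Gelfand's formula then gives `‖T ^ n‖ ≤ q ^ n` eventually, with `q < 1`. -/
theorem tendsto_pow_of_isUnit_one_sub_smul {B : Type*} [NormedRing B] [NormedAlgebra ℂ B]
    [CompleteSpace B] (T : B) (h : ∀ z : ℂ, ‖z‖ ≤ 1 → IsUnit (1 - z • T)) :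
    Tendsto (fun n : ℕ => T ^ n) atTop (𝓝 0) := by
  rcases subsingleton_or_nontrivial B with hs | hn
  · exact tendsto_const_nhds.congr fun n => Subsingleton.elim _ _
  have hr : spectralRadius ℂ T < (1 : NNReal) := by
    refine spectrum.spectralRadius_lt_of_forall_lt T fun k hk => ?_
    by_contra hlt
    have hk1 : 1 ≤ ‖k‖ := by
      rw [not_lt] at hlt
      exact_mod_cast hlt
    have hk0 : k ≠ 0 := by
      rintro rfl
      simp at hk1
      linarith
    refine spectrum.mem_iff.1 hk ?_
    have h1 := h k⁻¹ (by rw [norm_inv]; exact inv_le_one_of_one_le₀ hk1)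
    have h2 : algebraMap ℂ B k - T = k • (1 - k⁻¹ • T) := by
      rw [smul_sub, smul_inv_smul₀ hk0, Algebra.algebraMap_eq_smul_one]
    rw [h2]
    exact (h1.smul (Units.mk0 k hk0) :)
  obtain ⟨q, hq1, hq2⟩ := exists_between hr
  have hq2' : q < 1 := hq2
  lift q to NNReal using (hq2.trans ENNReal.coe_lt_top).ne
  have hev := (spectrum.pow_nnnorm_pow_one_div_tendsto_nhds_spectralRadius T).eventually_lt_const hq1
  have hq3 : q < 1 := by exact_mod_cast hq2'
  refine squeeze_zero_norm' ?_ (tendsto_pow_atTop_nhds_zero_of_lt_one q.2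
    (show (q : ℝ) < 1 from hq3))
  filter_upwards [hev, eventually_gt_atTop 0] with n hn hn0
  have hn1 : (0 : ℝ) < n := by exact_mod_cast hn0
  have h3 := (ENNReal.rpow_lt_rpow hn hn1).le
  rw [← ENNReal.rpow_mul, one_div, inv_mul_cancel₀ hn1.ne', ENNReal.rpow_one,
    ENNReal.rpow_natCast] at h3
  exact_mod_cast h3

end Powers

/-! ### Order and topology of the complexification. -/

namespace Complexification

section

variable {X : Type*} [AddCommGroup X] [Module ℝ X]

@[simp] theorem real_smul_re (c : ℝ) (z : Complexification X) : (c • z).re = c • z.re := by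
  change ((c : ℂ) • z).re = _
  rw [smul_re, Complex.ofReal_re, Complex.ofReal_im, zero_smul, sub_zero]

@[simp] theorem real_smul_im (c : ℝ) (z : Complexification X) : (c • z).im = c • z.im := by
  change ((c : ℂ) • z).im = _
  rw [smul_im, Complex.ofReal_re, Complex.ofReal_im, zero_smul, add_zero]

@[simp] theorem ofReal_re (x : X) : (ofReal x).re = x := rfl
@[simp] theorem ofReal_im (x : X) : (ofReal x).im = 0 := rfl

theorem ofReal_re_add_I_smul (z : Complexification X) :
    z = ofReal z.re + Complex.I • ofReal z.im := by
  ext <;> simp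

end

variable {X : Type*} [NormedAddCommGroup X] [NormedSpace ℝ X] [Lattice X]
  [IsOrderedAddMonoid X] [IsOrderedModule ℝ X]

instance : IsOrderedAddMonoid (Complexification X) where
  add_le_add_left _ _ h c := ⟨by simpa using h.1, by simp [h.2]⟩

instance : IsOrderedModule ℝ (Complexification X) where
  smul_le_smul_of_nonneg_left a ha z w h :=
    ⟨by simpa using smul_le_smul_of_nonneg_left h.1 ha, by simp [h.2]⟩
  smul_le_smul_of_nonneg_right z hz a b h :=
    ⟨by simpa using smul_le_smul_of_nonneg_right h hz.1, by
      have : z.im = 0 := hz.2.symm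
      simp [this]⟩

variable [HasSolidNorm X] [CompleteSpace X]

theorem continuous_re : Continuous (re : Complexification X → X) := by
  refine LipschitzWith.continuous (K := 1) (LipschitzWith.of_dist_le_mul fun z w => ?_)
  rw [dist_eq_norm, dist_eq_norm]
  simpa using norm_re_le (z - w)

theorem continuous_im : Continuous (im : Complexification X → X) := by
  refine LipschitzWith.continuous (K := 1) (LipschitzWith.of_dist_le_mul fun z w => ?_)
  rw [dist_eq_norm, dist_eq_norm]
  simpa using norm_im_le (z - w)

instance : OrderClosedTopology (Complexification X) where
  isClosed_le' := (isClosed_le (continuous_re.comp continuous_fst)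
    (continuous_re.comp continuous_snd)).inter (isClosed_eq (continuous_im.comp continuous_fst)
    (continuous_im.comp continuous_snd))

theorem ofReal_nonneg {x : X} (hx : 0 ≤ x) : 0 ≤ ofReal x := ⟨hx, rfl⟩

/-- A vector space statement which holds for all positive elements dominated by `|z|` holds
for `z`. -/
theorem map_eq_zero_of_nonneg {F : Type*} [AddCommGroup F] [Module ℂ F]
    (U : Complexification X →ₗ[ℂ] F) (z : Complexification X)
    (h : ∀ g : Complexification X, 0 ≤ g → g.re ≤ modulus z → U g = 0) : U z = 0 := by
  have key : ∀ x : X, |x| ≤ modulus z → U (ofReal x) = 0 := by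
    intro x hx
    have h1 : ofReal x = ofReal x⁺ - ofReal x⁻ := by
      ext <;> simp
    rw [h1, map_sub, h _ (ofReal_nonneg (posPart_nonneg x)) (
        (sup_le (le_abs_self x) (abs_nonneg x)).trans hx),
      h _ (ofReal_nonneg (negPart_nonneg x)) 
        ((sup_le (neg_le_abs x) (abs_nonneg x)).trans hx),
      sub_zero]
  rw [ofReal_re_add_I_smul z, map_add, map_smul, key _ (abs_re_le_modulus z),
    key _ (abs_im_le_modulus z), smul_zero, add_zero]

end Complexification

/-! ### Positive operators and quasi-interior points. -/

namespace EventualPositivity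

open Filter Complexification

variable {X : Type*} [NormedAddCommGroup X] [NormedSpace ℝ X] [Lattice X]
  [IsOrderedAddMonoid X] [IsOrderedModule ℝ X] [HasSolidNorm X] [CompleteSpace X]
  {u : Complexification X}

theorem stronglyPos_iff (hu : 0 ≤ u) {f : Complexification X} :
    StronglyPos u f ↔ ∃ c : ℝ, 0 < c ∧ c • u.re ≤ f.re ∧ f.im = 0 := by
  have h0 : ∀ c : ℝ, (c • u).im = 0 := fun c => by
    rw [real_smul_im, ← hu.2, zero_im, smul_zero]
  refine exists_congr fun c => and_congr_right fun _ => ?_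
  change (c • u).re ≤ f.re ∧ (c • u).im = f.im ↔ _
  rw [real_smul_re, h0, eq_comm (a := 0)]

theorem StronglyPos.nonneg (hu : 0 ≤ u) {f : Complexification X} (h : StronglyPos u f) :
    0 ≤ f := by
  obtain ⟨c, hc, h⟩ := h
  exact (smul_nonneg hc.le hu).trans h

theorem StronglyPos.smul {f : Complexification X} (h : StronglyPos u f) {a : ℝ} (ha : 0 < a) :
    StronglyPos u (a • f) := by
  obtain ⟨c, hc, h⟩ := h
  refine ⟨a * c, mul_pos ha hc, ?_⟩
  rw [mul_smul]
  exact smul_le_smul_of_nonneg_left h ha.le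

theorem map_mono_of_nonneg {U : Complexification X →L[ℂ] Complexification X}
    (hU : ∀ f, 0 ≤ f → 0 ≤ U f) {f g : Complexification X} (h : f ≤ g) : U f ≤ U g := by
  rw [← sub_nonneg, ← map_sub]
  exact hU _ (sub_nonneg.2 h)

theorem map_real_smul (U : Complexification X →L[ℂ] Complexification X) (c : ℝ)
    (f : Complexification X) : U (c • f) = c • U f := by
  change U ((c : ℂ) • f) = (c : ℂ) • U f
  exact map_smul _ _ _

theorem eq_zero_of_map_nonneg_eq_zero {U : Complexification X →L[ℂ] Complexification X}
    (h : ∀ f, 0 ≤ f → U f = 0) : U = 0 := by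
  ext1 z
  exact map_eq_zero_of_nonneg U.toLinearMap z fun g hg _ => h g hg

/-- A positive operator vanishing at a quasi-interior point is zero. -/
theorem eq_zero_of_map_quasiInterior_eq_zero (hu : IsQuasiInterior u)
    {U : Complexification X →L[ℂ] Complexification X} (hU : ∀ f, 0 ≤ f → 0 ≤ U f)
    (h : U u ≤ 0) : U = 0 := by
  -- If `0 ≤ g ≤ |z| ≤ c u`, then `0 ≤ U g ≤ c U u ≤ 0`. So `U` vanishes on `E_u`, and by density
  -- everywhere.
  have hd : Set.EqOn U (0 : Complexification X →L[ℂ] Complexification X) (principalIdeal u) := by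
    rintro z ⟨c, hc, hz⟩
    refine map_eq_zero_of_nonneg U.toLinearMap z fun g hg hgz => le_antisymm ?_ (hU g hg)
    have h1 : g ≤ c • u := by
      refine le_trans ⟨hgz, ?_⟩ hz
      exact hg.2.symm
    refine (map_mono_of_nonneg hU h1).trans ?_
    rw [map_real_smul]
    exact smul_nonpos_of_nonneg_of_nonpos hc h
  exact ContinuousLinearMap.ext fun z => congrFun
    (Continuous.ext_on hu.2 U.continuous (0 : Complexification X →L[ℂ] Complexification X).continuous
      hd) z

/-- A positive operator which is invariant under an eventually strongly positive family is
strongly positive and not nilpotent of order two. -/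
theorem stronglyPosOp_of_invariant {ι : Type*} {l : Filter ι} [NeBot l]
    (hu : IsQuasiInterior u) {T : ι → Complexification X →L[ℂ] Complexification X}
    {U : Complexification X →L[ℂ] Complexification X}
    (hT : ∀ f, 0 < f → ∀ᶠ i in l, StronglyPos u (T i f)) (hU : ∀ f, 0 ≤ f → 0 ≤ U f)
    (hne : U ≠ 0) (h1 : ∀ᶠ i in l, U * T i = U) (h2 : ∀ᶠ i in l, T i * U = U) :
    StronglyPosOp u U ∧ U * U ≠ 0 := by
  have hu0 := hu.1
  have hUu : ¬ U u ≤ 0 := fun h => hne (eq_zero_of_map_quasiInterior_eq_zero hu hU h)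
  have hdom : ∀ g, StronglyPos u g → U g ≠ 0 := by
    rintro g ⟨c, hc, hcg⟩ h0
    have h := map_mono_of_nonneg hU hcg
    rw [h0, map_real_smul] at h
    refine hUu ?_
    have h3 := smul_nonpos_of_nonneg_of_nonpos (inv_pos.2 hc).le h
    rwa [inv_smul_smul₀ hc.ne'] at h3
  -- Invariance on the right: `U f = U (T i f)` with `T i f ≥ c u`, and `U` kills no such vector.
  -- Invariance on the left, `U f = T i (U f)`, then upgrades this to strong positivity.
  have hpos : ∀ f, 0 < f → 0 < U f := by
    intro f hf
    refine lt_of_le_of_ne (hU f hf.le) fun h0 => ?_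
    obtain ⟨i, hi, hi1⟩ := ((hT f hf).and h1).exists
    refine hdom _ hi ?_
    rw [← mul_apply_eq_comp, hi1, ← h0]
  have hstrong : StronglyPosOp u U := by
    intro f hf
    obtain ⟨i, hi, hi2⟩ := ((hT _ (hpos f hf)).and h2).exists
    rwa [← mul_apply_eq_comp, hi2] at hi
  refine ⟨hstrong, fun h0 => hne (eq_zero_of_map_nonneg_eq_zero fun f hf => ?_)⟩
  rcases hf.eq_or_lt with rfl | hf
  · exact map_zero U
  · refine absurd ?_ (hpos _ (hpos f hf)).ne'
    rw [← mul_apply_eq_comp, h0, zero_apply]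

/-! ### Domination -/

/-- A bounded operator with range in the principal ideal `E_u` is bounded into `E_u`. -/
theorem exists_bound_of_range_subset (hu : 0 ≤ u)
    {T : Complexification X →L[ℂ] Complexification X} (hT : ∀ g, T g ∈ principalIdeal u) :
    ∃ C : ℝ, ∀ g, -((C * ‖g‖) • u.re) ≤ (T g).re := by
  have hc : Continuous fun g => (T g).re := continuous_re.comp T.continuous
  -- Baire: the closed sets where `|Re T g| ≤ n u` cover `E`, so one of them contains a ball.
  obtain ⟨n, x, hx⟩ := nonempty_interior_of_iUnion_of_closed
    (f := fun n : ℕ => {g | (T g).re ≤ (n : ℝ) • u.re} ∩ {g | -((n : ℝ) • u.re) ≤ (T g).re})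
    (fun n => (isClosed_le hc continuous_const).inter (isClosed_le continuous_const hc))
    (by
      refine Set.eq_univ_of_forall fun g => Set.mem_iUnion.2 ?_
      obtain ⟨c, hc, hg⟩ := hT g
      obtain ⟨n, hn⟩ := exists_nat_ge c
      have h1 : |(T g).re| ≤ (n : ℝ) • u.re := by
        refine (abs_re_le_modulus _).trans (le_trans (by simpa using hg.1) ?_)
        exact smul_le_smul_of_nonneg_right hn hu.1
      exact ⟨n, (abs_le'.1 h1).1, neg_le.1 (abs_le'.1 h1).2⟩)
  rw [mem_interior_iff_mem_nhds, Metric.mem_nhds_iff] at hx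
  obtain ⟨ε, hε, hball⟩ := hx
  -- With `t = ε / (2‖g‖)`, the difference of `T` at `x + t g` and at `x` is at least `-2n u`;
  -- dividing by `t` gives the constant.
  refine ⟨4 * n / ε, fun g => ?_⟩
  rcases eq_or_ne g 0 with rfl | hg
  · simp
  have hg0 : 0 < ‖g‖ := norm_pos_iff.2 hg
  set t : ℝ := ε / (2 * ‖g‖) with ht
  have ht0 : 0 < t := by positivity
  have h1 := (hball (Metric.mem_ball_self hε)).1
  have h2 : x + (t : ℂ) • g ∈ Metric.ball x ε := by
    rw [mem_ball_iff_norm, add_sub_cancel_left, norm_smul, Complex.norm_real, Real.norm_of_nonneg ht0.le,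
      ht]
    field_simp
    linarith
  have h3 := (hball h2).2
  simp only [Set.mem_ofPred_eq, map_add, map_smul, add_re, smul_re, Complex.ofReal_re,
    Complex.ofReal_im, zero_smul, sub_zero] at h1 h3
  have h4 : -((2 * n : ℝ) • u.re) ≤ t • (T g).re := by
    have h5 : -((n : ℝ) • u.re) - (n : ℝ) • u.re ≤ t • (T g).re := by
      rw [sub_le_iff_le_add']
      exact h3.trans (add_le_add_left h1 _)
    refine le_trans (le_of_eq ?_) h5
    module
  have h6 := smul_le_smul_of_nonneg_left h4 (inv_pos.2 ht0).le
  rw [inv_smul_smul₀ ht0.ne'] at h6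
  refine le_trans (le_of_eq ?_) h6
  rw [smul_neg, smul_smul]
  congr 2
  rw [ht]
  field_simp
  ring

/-- Turns norm convergence into an order bound: `T (g i)` is at least `T g₀ - C ‖g i - g₀‖ u`, and
half of the lower bound of `T g₀` survives. Imaginary parts are handled separately because
comparable elements have equal ones. -/
theorem eventually_stronglyPos_of_tendsto (hu : 0 ≤ u)
    {T : Complexification X →L[ℂ] Complexification X} (hT : ∀ g, T g ∈ principalIdeal u)
    {ι : Type*} {l : Filter ι} {g : ι → Complexification X} {g₀ : Complexification X}
    (hg : Tendsto g l (𝓝 g₀)) (h0 : StronglyPos u (T g₀))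
    (him : ∀ᶠ i in l, (T (g i)).im = 0) : ∀ᶠ i in l, StronglyPos u (T (g i)) := by
  obtain ⟨C, hC⟩ := exists_bound_of_range_subset hu hT
  obtain ⟨c, hc, hcu, -⟩ := (stronglyPos_iff hu).1 h0
  have hlim : Tendsto (fun i => C * ‖g i - g₀‖) l (𝓝 0) := by
    simpa using (tendsto_iff_norm_sub_tendsto_zero.1 hg).const_mul C
  filter_upwards [hlim.eventually_lt_const (half_pos hc), him] with i hi him
  refine (stronglyPos_iff hu).2 ⟨c / 2, half_pos hc, ?_, him⟩
  have h1 := hC (g i - g₀)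
  rw [map_sub, sub_re, le_sub_iff_add_le] at h1
  refine le_trans ?_ h1
  refine le_trans ?_ (add_le_add (neg_le_neg (smul_le_smul_of_nonneg_right hi.le hu.1)) hcu)
  refine le_of_eq ?_
  module

end EventualPositivity

/-! ### Spectral projections, simple poles and convergence of powers. -/

namespace EventualPositivity

open Filter

section SpectralProjection

variable {E : Type*} [NormedAddCommGroup E] [NormedSpace ℂ E] [CompleteSpace E]
  {A : E →ₗ.[ℂ] E} {μ : ℂ} {P : E →L[ℂ] E}

theorem IsSpectralProjection.exists_laurentCoeff (hP : IsSpectralProjection A μ P) :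
    ∃ r : ℝ, 0 < r ∧ Metric.closedBall μ r \ {μ} ⊆ resolventSet A ∧
      P = laurentCoeff A μ r 0 ∧ ∃ w ∈ resolventSet A, w ≠ μ := by
  obtain ⟨r, hr, hball, rfl⟩ := hP
  refine ⟨r, hr, hball, by simp [laurentCoeff], μ + r, ?_, by simpa using hr.ne'⟩
  exact sphere_subset_resolventSet hr hball (by simp [abs_of_pos hr])

/-- The recursion at `k = 0`, after commuting, has `R(w)` as a left factor. This places the range of
`P` in the domain, and lets `Q R(w) = 0` imply `Q P = 0`. -/
theorem IsSpectralProjection.exists_eq_resolvent_mul (hP : IsSpectralProjection A μ P) :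
    ∃ w ∈ resolventSet A, ∃ B : E →L[ℂ] E, P = resolvent A w * B := by
  obtain ⟨r, hr, hball, rfl, w, hw, -⟩ := hP.exists_laurentCoeff
  refine ⟨w, hw, (w - μ) • laurentCoeff A μ r 0 - laurentCoeff A μ r 1, ?_⟩
  have h := laurentCoeff_mul_resolvent hr hball 0 hw
  rw [zero_add] at h
  rw [mul_sub, mul_smul_comm, ← laurentCoeff_commute hr hball 0 hw,
    ← laurentCoeff_commute hr hball 1 hw, ← h]
  abel

theorem IsSpectralProjection.mem_domain (hP : IsSpectralProjection A μ P) (f : E) :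
    P f ∈ A.domain := by
  obtain ⟨w, hw, B, rfl⟩ := hP.exists_eq_resolvent_mul
  exact resolvent_mem_domain hw _

/-- On an eigenvector the resolvent acts as the scalar `(z - μ)⁻¹`, whose contour integral is `2πi`.
-/
theorem IsSpectralProjection.apply_eigenvector (hP : IsSpectralProjection A μ P)
    (f : A.domain) (hf : A f = μ • (f : E)) : P f = f := by
  obtain ⟨r, hr, hball, rfl, -⟩ := hP.exists_laurentCoeff
  have h := map_laurentCoeff (ContinuousLinearMap.apply ℂ E (f : E)) hr hball 0
  simp only [ContinuousLinearMap.apply_apply, pow_zero, one_smul] at h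
  have h2 : (∮ z in C(μ, r), resolvent A z (f : E)) = ∮ z in C(μ, r), (z - μ)⁻¹ • (f : E) := by
    refine circleIntegral.integral_congr hr.le fun z hz => ?_
    have hz' := sphere_subset_resolventSet hr hball hz
    have hne : z - μ ≠ 0 := by
      intro h0
      rw [sub_eq_zero] at h0
      subst h0
      simp at hz
      exact hr.ne hz
    exact (eq_inv_smul_iff₀ hne).2 (resolvent_eigenvector hz' f hf)
  rw [h, h2, circleIntegral.integral_smul_const (fun z => (z - μ)⁻¹),
    circleIntegral.integral_sub_center_inv μ hr.ne', inv_smul_smul₀ Complex.two_pi_I_ne_zero]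

/-- The leading Laurent coefficient of the resolvent at a pole. -/
theorem IsPoleOfResolvent.exists_leadingCoeff (h : IsPoleOfResolvent A μ)
    (hP : IsSpectralProjection A μ P) :
    ∃ (m : ℕ) (U : E →L[ℂ] E), U ≠ 0 ∧
      Tendsto (fun z => (z - μ) ^ (m + 1) • resolvent A z) (𝓝[≠] μ) (𝓝 U) ∧
      (∀ w ∈ resolventSet A, (w - μ) • (U * resolvent A w) = U) ∧
      (∀ w ∈ resolventSet A, (w - μ) • (resolvent A w * U) = U) ∧
      (U * U ≠ 0 → m = 0 ∧ P = U) := by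
  obtain ⟨m, U, hU, hlim, -, hc⟩ := h.exists_leading
  obtain ⟨r, hr, hball, hP0, -⟩ := hP.exists_laurentCoeff
  obtain ⟨hm, hk⟩ := hc r hr hball
  have h1 : ∀ w ∈ resolventSet A, (w - μ) • (U * resolvent A w) = U := by
    intro w hw
    have h2 := laurentCoeff_mul_resolvent hr hball m hw
    rwa [hm, hk (m + 1) (Nat.lt_succ_self m), zero_mul, sub_eq_zero] at h2
  have h2 : ∀ w ∈ resolventSet A, (w - μ) • (resolvent A w * U) = U := by
    intro w hw
    have h3 := laurentCoeff_commute hr hball m hw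
    rw [hm] at h3
    rw [← h3, h1 w hw]
  refine ⟨m, U, hU, hlim, h1, h2, fun hne => ?_⟩
  -- Since `(z - μ) R(z) U = U`, the product `(z - μ)^(m+1) R(z) U` equals `(z - μ)^m U`. Its limit
  -- is `U * U`, but also zero if `m > 0`.
  have hm0 : m = 0 := by
    by_contra hm0
    refine hne ?_
    have h4 := hlim.mul_const U
    have h5 : Tendsto (fun z => (z - μ) ^ m • U) (𝓝[≠] μ) (𝓝 0) := by
      have hcont : Continuous fun z : ℂ => (z - μ) ^ m • U := by fun_prop
      have := (hcont.tendsto μ).mono_left (nhdsWithin_le_nhds (s := {μ}ᶜ))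
      simpa [hm0] using this
    refine tendsto_nhds_unique (h4.congr' ?_) h5
    filter_upwards [h.2.1] with z hz
    nth_rw 2 [← h2 z hz]
    rw [smul_mul_assoc, smul_smul, pow_succ]
  subst hm0
  exact ⟨rfl, hP0.trans hm⟩

/-- If the spectral projection of an eigenvalue has rank one, then the pole is simple. -/
theorem IsPoleOfResolvent.simple (h : IsPoleOfResolvent A μ)
    (hP : IsSpectralProjection A μ P) (heig : IsEigenvalue A μ) {v : E}
    (hv : ∀ f, ∃ α : ℂ, P f = α • v) :
    Tendsto (fun z => (z - μ) • resolvent A z) (𝓝[≠] μ) (𝓝 P) ∧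
      (∃ L : E →L[ℂ] E, Tendsto (fun z => resolvent A z - (z - μ)⁻¹ • P) (𝓝[≠] μ) (𝓝 L)) ∧
      (∀ w ∈ resolventSet A, (w - μ) • (P * resolvent A w) = P) ∧
      (∀ w ∈ resolventSet A, (w - μ) • (resolvent A w * P) = P) := by
  obtain ⟨m, U, hU, hlim, hL, hc⟩ := h.exists_leading
  obtain ⟨r, hr, hball, hP0, w, hw, hwμ⟩ := hP.exists_laurentCoeff
  obtain ⟨hm, hk⟩ := hc r hr hball
  obtain ⟨w', hw', B, hB⟩ := hP.exists_eq_resolvent_mul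
  have hmul := laurentCoeff_zero_mul hr hball hk
  rw [← hP0] at hmul
  obtain ⟨e, he0, he⟩ := heig
  have hPe := hP.apply_eigenvector e he
  -- The recursion applied to the eigenvector `e` gives `Q_1 e = 0`. As `e` spans the range of `P`
  -- and `Q_1 = Q_1 P`, nothing of `Q_1` remains.
  have hone : laurentCoeff A μ r 1 = 0 := by
    have h1 := congrArg (fun T : E →L[ℂ] E => T e) (laurentCoeff_mul_resolvent hr hball 0 hw)
    have h2 := resolvent_eigenvector hw e he
    have hne := sub_ne_zero.2 hwμ
    simp only [sub_apply, smul_apply, mul_apply_eq_comp, ← map_smul, h2, sub_self,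
      zero_add] at h1
    have h3 : laurentCoeff A μ r 1 (e : E) = 0 := by
      rw [← h2, map_smul, ← h1, smul_zero]
    obtain ⟨α, hα⟩ := hv e
    rw [hPe] at hα
    have hα0 : α ≠ 0 := by
      rintro rfl
      exact he0 (by rw [hα, zero_smul])
    rw [hα, map_smul, smul_eq_zero_iff_right hα0] at h3
    ext f
    obtain ⟨β, hβ⟩ := hv f
    rw [← hmul 1, mul_apply_eq_comp, hβ, map_smul, h3, smul_zero, zero_apply]
  -- Once a coefficient vanishes, the next one is killed by right multiplication with `R(w')`, hence
  -- with `P = R(w') B`, which leaves it unchanged.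
  have hall : ∀ k, laurentCoeff A μ r (k + 1) = 0 := by
    intro k
    induction k with
    | zero => exact hone
    | succ k ih =>
      have h1 := laurentCoeff_mul_resolvent hr hball (k + 1) hw'
      rw [ih, zero_mul, smul_zero, sub_zero] at h1
      rw [← hmul, hB, ← mul_assoc, ← h1, zero_mul]
  have hm0 : m = 0 := by
    rcases m with _ | m
    · rfl
    · exact absurd (hm.symm.trans (hall m)) hU
  subst hm0
  have hPU : P = U := hP0.trans hm
  rw [← hPU] at hlim hL
  have h1 : ∀ w ∈ resolventSet A, (w - μ) • (P * resolvent A w) = P := by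
    intro w hw
    have h2 := laurentCoeff_mul_resolvent hr hball 0 hw
    rwa [← hP0, hall 0, zero_mul, sub_eq_zero] at h2
  refine ⟨by simpa using hlim, hL rfl, h1, fun w hw => ?_⟩
  have h3 := laurentCoeff_commute hr hball 0 hw
  rw [← hP0] at h3
  rw [← h3, h1 w hw]

theorem IsSpectralProjection.mul_self (hP : IsSpectralProjection A μ P)
    (h : IsPoleOfResolvent A μ) : P * P = P := by
  obtain ⟨m, U, hU, hlim, hL, hc⟩ := h.exists_leading
  obtain ⟨r, hr, hball, hP0, -⟩ := hP.exists_laurentCoeff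
  rw [hP0]
  exact laurentCoeff_zero_mul hr hball (hc r hr hball).2 0

theorem mem_resolventSet_of_spectralBound_lt {z : ℂ}
    (hz : spectralBound A < (z.re : EReal)) : z ∈ resolventSet A := by
  by_contra h
  exact absurd hz (not_lt.2 (le_sSup ⟨z, h, rfl⟩))

/-- Formally the operator is `(z - c - A) R(z)`, so its inverse is `(z - A) R(z - c) = 1 + c R(z -
c)`. -/
theorem isUnit_one_sub_smul_resolvent {z c : ℂ} (hz : z ∈ resolventSet A)
    (hc : z - c ∈ resolventSet A) : IsUnit (1 - c • resolvent A z) := by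
  have h1 := one_add_mul_resolvent hc hz
  have h2 := resolvent_mul_one_add hc hz
  have h3 : (1 : E →L[ℂ] E) + (z - c - z) • resolvent A z = 1 - c • resolvent A z := by
    module
  rw [h3] at h1 h2
  refine ⟨⟨_, 1 + c • resolvent A (z - c), ?_, ?_⟩, rfl⟩
  · rw [mul_add, mul_smul_comm, h1]
    simp
  · rw [add_mul, smul_mul_assoc, h2]
    simp

/-- The powers of `(z - μ) R(z, A)` converge to the spectral projection of a simple pole which
is strictly dominant as seen from `z`. -/
theorem tendsto_pow_smul_resolvent
    (hL : ∃ L : E →L[ℂ] E, Tendsto (fun z => resolvent A z - (z - μ)⁻¹ • P) (𝓝[≠] μ) (𝓝 L))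
    (hPR : ∀ w ∈ resolventSet A, (w - μ) • (P * resolvent A w) = P)
    (hRP : ∀ w ∈ resolventSet A, (w - μ) • (resolvent A w * P) = P)
    (hPP : P * P = P) (hev : ∀ᶠ z in 𝓝[≠] μ, z ∈ resolventSet A)
    {z : ℂ} (hz : z ∈ resolventSet A) (hzμ : z ≠ μ)
    (hdom : ∀ c : ℂ, ‖c‖ ≤ 1 → z - c * (z - μ) ≠ μ → z - c * (z - μ) ∈ resolventSet A) :
    Tendsto (fun n : ℕ => ((z - μ) • resolvent A z) ^ n) atTop (𝓝 P) := by
  set T := (z - μ) • resolvent A z with hTdef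
  have hTP : T * P = P := by rw [hTdef, smul_mul_assoc, hRP z hz]
  have hPT : P * T = P := by rw [hTdef, mul_smul_comm, hPR z hz]
  have ha : z - μ ≠ 0 := sub_ne_zero.2 hzμ
  -- `T = S + P` with `S P = P S = 0`, so `T ^ n = S ^ n + P` for `n ≥ 1`, and it remains to show
  -- that `S ^ n` tends to zero.
  set S := T - P with hSdef
  have hSP : S * P = 0 := by rw [hSdef, sub_mul, hTP, hPP, sub_self]
  have hPS : P * S = 0 := by rw [hSdef, mul_sub, hPT, hPP, sub_self]
  -- the reduced resolvent at `w ≠ μ`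
  have hH : ∀ w ∈ resolventSet A, w ≠ μ →
      (1 + ((w - z) / (z - μ)) • T) * (resolvent A w - (w - μ)⁻¹ • P) = (z - μ)⁻¹ • S ∧
      (resolvent A w - (w - μ)⁻¹ • P) * (1 + ((w - z) / (z - μ)) • T) = (z - μ)⁻¹ • S ∧
      P * (resolvent A w - (w - μ)⁻¹ • P) = 0 ∧ (resolvent A w - (w - μ)⁻¹ • P) * P = 0 := by
    intro w hw hwμ
    have hb : w - μ ≠ 0 := sub_ne_zero.2 hwμ
    have e1 : ((w - z) / (z - μ)) • T = (w - z) • resolvent A z := by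
      rw [hTdef, smul_smul, div_mul_cancel₀ _ ha]
    have e2 := one_add_mul_resolvent hw hz
    have e3 := resolvent_mul_one_add hw hz
    have e4 : (z - μ)⁻¹ • S = resolvent A z - (z - μ)⁻¹ • P := by
      rw [hSdef, smul_sub, hTdef, inv_smul_smul₀ ha]
    have e5 : (1 + ((w - z) / (z - μ)) • T) * P = ((w - μ) / (z - μ)) • P := by
      rw [add_mul, smul_mul_assoc, hTP, one_mul]
      nth_rw 1 [← one_smul ℂ P]
      rw [← add_smul]
      congr 1
      field_simp
      ring
    have e6 : P * (1 + ((w - z) / (z - μ)) • T) = ((w - μ) / (z - μ)) • P := by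
      rw [← e5, mul_add, add_mul, mul_smul_comm, smul_mul_assoc, hTP, hPT, one_mul, mul_one]
    have e7 : (w - μ)⁻¹ * ((w - μ) / (z - μ)) = (z - μ)⁻¹ := by field_simp
    refine ⟨?_, ?_, ?_, ?_⟩
    · rw [mul_sub, mul_smul_comm, e5, e1, e2, smul_smul, e7, e4]
    · rw [sub_mul, smul_mul_assoc, e6, e1, e3, smul_smul, e7, e4]
    · rw [mul_sub, mul_smul_comm, hPP, sub_eq_zero, eq_inv_smul_iff₀ hb, hPR w hw]
    · rw [sub_mul, smul_mul_assoc, hPP, sub_eq_zero, eq_inv_smul_iff₀ hb, hRP w hw]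
  -- `H` is the reduced resolvent at `w = z - c (z - μ)`. For `c = 1` this point is `μ` itself, and
  -- `H` is the limit `L` of the regular part.
  have hex : ∀ c : ℂ, ‖c‖ ≤ 1 → ∃ H : E →L[ℂ] E,
      (1 - c • T) * H = (z - μ)⁻¹ • S ∧ H * (1 - c • T) = (z - μ)⁻¹ • S ∧
      P * H = 0 ∧ H * P = 0 := by
    intro c hc
    by_cases hw : z - c * (z - μ) = μ
    · obtain ⟨L, hL⟩ := hL
      have hc1 : c = 1 := by
        have : (1 - c) * (z - μ) = 0 := by linear_combination hw
        rcases mul_eq_zero.1 this with h | h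
        · linear_combination -h
        · exact absurd h ha
      subst hc1
      have hcoef : Tendsto (fun w : ℂ => (1 : E →L[ℂ] E) + ((w - z) / (z - μ)) • T) (𝓝[≠] μ)
          (𝓝 (1 - (1 : ℂ) • T)) := by
        have hcont : Continuous fun w : ℂ => (1 : E →L[ℂ] E) + ((w - z) / (z - μ)) • T := by
          fun_prop
        have h1 := (hcont.tendsto μ).mono_left (nhdsWithin_le_nhds (s := {μ}ᶜ))
        have h2 : (μ - z) / (z - μ) = -1 := by
          field_simp
          ring
        rwa [h2, neg_smul, ← sub_eq_add_neg] at h1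
      have hev' := hev.and (eventually_mem_nhdsWithin (a := μ) (s := {μ}ᶜ))
      refine ⟨L, tendsto_nhds_unique (hcoef.mul hL) ?_, tendsto_nhds_unique (hL.mul hcoef) ?_,
        tendsto_nhds_unique (hL.const_mul P) ?_, tendsto_nhds_unique (hL.mul_const P) ?_⟩
      · exact tendsto_const_nhds.congr' (hev'.mono fun w h => (hH w h.1 h.2).1.symm)
      · exact tendsto_const_nhds.congr' (hev'.mono fun w h => (hH w h.1 h.2).2.1.symm)
      · exact tendsto_const_nhds.congr' (hev'.mono fun w h => (hH w h.1 h.2).2.2.1.symm)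
      · exact tendsto_const_nhds.congr' (hev'.mono fun w h => (hH w h.1 h.2).2.2.2.symm)
    · have h := hH _ (hdom c hc hw) hw
      have h1 : (z - c * (z - μ) - z) / (z - μ) = -c := by
        field_simp
        ring
      rw [h1, neg_smul, ← sub_eq_add_neg] at h
      exact ⟨_, h⟩
  have hunit : ∀ c : ℂ, ‖c‖ ≤ 1 → IsUnit (1 - c • S) := by
    intro c hc
    obtain ⟨H, h1, h2, h3, h4⟩ := hex c hc
    have e : (1 : E →L[ℂ] E) - c • S = (1 - c • T) + c • P := by
      rw [hSdef]
      module
    have hs : (c * (z - μ)) • (z - μ)⁻¹ • S = c • S := by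
      rw [smul_smul, mul_assoc, mul_inv_cancel₀ ha, mul_one]
    -- As `1 - c S = (1 - c T) + c P` and `H` is annihilated by `P`, multiplying by `c (z - μ) H` on
    -- either side gives exactly `c S`.
    refine ⟨⟨_, 1 + (c * (z - μ)) • H, ?_, ?_⟩, rfl⟩
    · rw [mul_add, mul_one, mul_smul_comm]
      nth_rw 2 [e]
      rw [add_mul, h1, smul_mul_assoc, h3, smul_zero, add_zero, hs, sub_add_cancel]
    · rw [add_mul, one_mul, smul_mul_assoc]
      nth_rw 2 [e]
      rw [mul_add, h2, mul_smul_comm, h4, smul_zero, add_zero, hs, sub_add_cancel]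
  have hpow : ∀ n : ℕ, T ^ (n + 1) = S ^ (n + 1) + P := by
    intro n
    induction n with
    | zero => simp [hSdef]
    | succ n ih =>
      have hT : T = S + P := by rw [hSdef, sub_add_cancel]
      have h0 : S ^ (n + 1) * P = 0 := by rw [pow_succ, mul_assoc, hSP, mul_zero]
      rw [pow_succ, ih, pow_succ S (n + 1), hT, add_mul, mul_add, mul_add, h0, hPS, hPP]
      abel
  rw [← tendsto_add_atTop_iff_nat 1]
  simp only [hpow]
  simpa using ((tendsto_add_atTop_iff_nat 1).2
    (tendsto_pow_of_isUnit_one_sub_smul S hunit)).add_const P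

end SpectralProjection
end EventualPositivity

/-! ### Passage between the spectral projection and the resolvent. -/

namespace EventualPositivity

open Filter Complexification

variable {X : Type*} [NormedAddCommGroup X] [NormedSpace ℝ X] [Lattice X]
  [IsOrderedAddMonoid X] [IsOrderedModule ℝ X] [HasSolidNorm X] [CompleteSpace X]
  {u : Complexification X} {A : Complexification X →ₗ.[ℂ] Complexification X}
  {P : Complexification X →L[ℂ] Complexification X} {l₀ : ℝ}

/-- A strongly positive projection with range in `E_u` has rank one. -/
theorem StronglyPosOp.exists_eq_smul (hu : 0 ≤ u) (hu0 : u ≠ 0) (hP : StronglyPosOp u P)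
    (hPP : P * P = P) (hdom : ∀ f, P f ∈ principalIdeal u) (f : Complexification X) :
    ∃ α : ℂ, P f = α • P u := by
  have hupos : 0 < u := lt_of_le_of_ne hu hu0.symm
  set v := P u with hv
  have hPv : P v = v := by rw [hv, ← mul_apply_eq_comp, hPP]
  obtain ⟨c, hc, hcv⟩ := hP u hupos
  rw [← hv] at hcv
  obtain ⟨d, hd, hvd⟩ := hdom u
  have hu_re : ∀ a : ℝ, 0 ≤ a • u.re → 0 ≤ a := by
    intro a ha
    by_contra hneg
    rw [not_le] at hneg
    have h1 : a • u ≤ 0 := smul_nonpos_of_nonpos_of_nonneg hneg.le hu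
    have h2 : 0 ≤ a • u := ⟨by simpa using ha, by simp [← hu.2]⟩
    have h3 := le_antisymm h1 h2
    rw [smul_eq_zero] at h3
    exact h3.elim hneg.ne hu0
  have hv_re : c • u.re ≤ v.re := by simpa using hcv.1
  have hv_im : v.im = 0 := by
    have := hcv.2
    rw [real_smul_im, ← hu.2, zero_im, smul_zero] at this
    exact this.symm
  have hv_d : v.re ≤ d • u.re := by
    refine (le_abs_self _).trans ((abs_re_le_modulus v).trans ?_)
    simpa using hvd.1
  -- real elements of the range
  have key : ∀ h : Complexification X, P h = h → h.im = 0 → ∃ t : ℝ, h = t • v := by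
    intro h hPh him
    obtain ⟨b, hb, hhb⟩ := hdom h
    rw [hPh] at hhb
    have hhb' : |h.re| ≤ b • u.re := (abs_re_le_modulus h).trans (by simpa using hhb.1)
    obtain ⟨hb1, hb2⟩ := abs_le'.1 hhb'
    -- Push `h` along `v` to the boundary of the cone. At the least `t₀`, the vector `h + t₀ v` is
    -- positive and fixed by `P`; were it nonzero, it would dominate a multiple of `u`, hence of
    -- `v`, and `t₀` could be lowered.
    set s : Set ℝ := {t | 0 ≤ h.re + t • v.re} with hs
    have hclosed : IsClosed s :=
      isClosed_le continuous_const (continuous_const.add (continuous_id.smul continuous_const))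
    have hne : s.Nonempty := by
      refine ⟨b / c, ?_⟩
      have h1 : (b / c) • c • u.re ≤ (b / c) • v.re :=
        smul_le_smul_of_nonneg_left hv_re (div_nonneg hb hc.le)
      rw [smul_smul, div_mul_cancel₀ _ hc.ne'] at h1
      change 0 ≤ h.re + (b / c) • v.re
      rw [← neg_le_iff_add_nonneg']
      exact hb2.trans h1
    have hbdd : BddBelow s := by
      refine ⟨-(b / c), fun t ht => ?_⟩
      rcases le_total 0 t with h0 | h0
      · exact (neg_nonpos.2 (div_nonneg hb hc.le)).trans h0
      have h1 : (-t) • c • u.re ≤ (-t) • v.re :=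
        smul_le_smul_of_nonneg_left hv_re (neg_nonneg.2 h0)
      have h2 : (-t) • v.re ≤ b • u.re := by
        rw [neg_smul]
        exact (neg_le_iff_add_nonneg.2 ht).trans hb1
      have h3 : 0 ≤ (b + t * c) • u.re := by
        have := sub_nonneg.2 (h1.trans h2)
        refine this.trans_eq ?_
        module
      have h4 := hu_re _ h3
      rw [neg_le, le_div_iff₀ hc]
      linarith
    have hmem : 0 ≤ h.re + sInf s • v.re := hclosed.csInf_mem hne hbdd
    set t₀ := sInf s with ht₀
    set g := h + t₀ • v with hg
    have hg0 : 0 ≤ g := ⟨by rw [hg, add_re, real_smul_re]; exact hmem, by simp [hg, him, hv_im]⟩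
    have hPg : P g = g := by rw [hg, map_add, map_real_smul, hPh, hPv]
    refine ⟨-t₀, ?_⟩
    rcases hg0.eq_or_lt with h0 | hgpos
    · rw [neg_smul]
      exact eq_neg_of_add_eq_zero_left h0.symm
    exfalso
    obtain ⟨a, ha, hag, -⟩ := (stronglyPos_iff hu).1 (hPg ▸ hP g hgpos)
    -- Only `d ≥ 0` is known, so `d + 1` serves as a positive divisor.
    have hd1 : 0 < d + 1 := by linarith
    have hmem' : t₀ - a / (d + 1) ∈ s := by
      have h1 : (a / (d + 1)) • v.re ≤ a • u.re := by
        have h2 : v.re ≤ (d + 1) • u.re := by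
          refine hv_d.trans (smul_le_smul_of_nonneg_right (by linarith) hu.1)
        have h3 := smul_le_smul_of_nonneg_left h2 (div_pos ha hd1).le
        rwa [smul_smul, div_mul_cancel₀ _ hd1.ne'] at h3
      have h4 := sub_nonneg.2 (h1.trans hag)
      change 0 ≤ h.re + (t₀ - a / (d + 1)) • v.re
      refine h4.trans_eq ?_
      simp only [hg, add_re, real_smul_re]
      module
    have h5 := csInf_le hbdd hmem'
    rw [← ht₀] at h5
    have h6 := div_pos ha hd1
    linarith
  have hreal : ∀ x : X, (P (ofReal x)).im = 0 := by
    have hpos : ∀ x : X, 0 ≤ x → (P (ofReal x)).im = 0 := by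
      intro x hx
      rcases (ofReal_nonneg hx).eq_or_lt with h0 | h0
      · rw [← h0, map_zero, zero_im]
      · obtain ⟨-, -, -, h⟩ := (stronglyPos_iff hu).1 (hP _ h0)
        exact h
    intro x
    have h1 : ofReal x = ofReal x⁺ - ofReal x⁻ := by
      ext <;> simp
    rw [h1, map_sub, sub_im, hpos _ (posPart_nonneg x), hpos _ (negPart_nonneg x), sub_zero]
  have hPP' : ∀ g, P (P g) = P g := fun g => by rw [← mul_apply_eq_comp, hPP]
  obtain ⟨s, hs⟩ := key (P (ofReal f.re)) (hPP' _) (hreal _)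
  obtain ⟨t, ht⟩ := key (P (ofReal f.im)) (hPP' _) (hreal _)
  refine ⟨(s : ℂ) + Complex.I * t, ?_⟩
  rw [ofReal_re_add_I_smul f, map_add, map_smul, hs, ht, add_smul, mul_smul]
  rfl

/-- The resolvent of a real operator is real at real points. -/
theorem im_resolvent_eq_zero (hA : IsRealOperator A) {l : ℝ} (hl : (l : ℂ) ∈ resolventSet A)
    {f : Complexification X} (hf : f.im = 0) : (resolvent A (l : ℂ) f).im = 0 := by
  obtain ⟨x, y, hx, hy, hxy⟩ := (hA.1 _).1 (resolvent_mem_domain hl f)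
  have h1 := sub_apply_resolvent hl f (resolvent_mem_domain hl f)
  set x' : A.domain := ⟨ofReal x, hx⟩
  set y' : A.domain := ⟨ofReal y, hy⟩
  have h2 : (⟨resolvent A (l : ℂ) f, resolvent_mem_domain hl f⟩ : A.domain) =
      x' + Complex.I • y' := Subtype.ext hxy
  have hAx : (A x').im = 0 := hA.2 x' rfl
  have hAy : (A y').im = 0 := hA.2 y' rfl
  rw [h2, hxy, LinearPMap.map_add, LinearPMap.map_smul] at h1
  have h3 := congrArg Complexification.im h1
  simp [hAx, hf] at h3
  -- The imaginary part of `(l - A)(x + i y) = f` reads `(l - A) y = 0`, and `l - A` is injective.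
  have h4 : (l : ℂ) • (y' : Complexification X) - A y' = 0 := by
    ext
    · simpa [y'] using h3
    · simp [hAy, y']
  have h5 := resolvent_sub_apply hl y'
  rw [h4, map_zero] at h5
  have h6 : y = 0 := (congrArg Complexification.re h5).symm
  rw [hxy, h6]
  simp

theorem tendsto_ofReal_nhdsGT : Tendsto (fun t : ℝ => (t : ℂ)) (𝓝[>] l₀) (𝓝[≠] (l₀ : ℂ)) := by
  refine tendsto_nhdsWithin_iff.2 ⟨?_, ?_⟩
  · exact (Complex.continuous_ofReal.tendsto l₀).mono_left nhdsWithin_le_nhds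
  · filter_upwards [self_mem_nhdsWithin] with t ht
    simpa using ht.ne'

theorem tendsto_ofReal_nhdsLT : Tendsto (fun t : ℝ => (t : ℂ)) (𝓝[<] l₀) (𝓝[≠] (l₀ : ℂ)) := by
  refine tendsto_nhdsWithin_iff.2 ⟨?_, ?_⟩
  · exact (Complex.continuous_ofReal.tendsto l₀).mono_left nhdsWithin_le_nhds
  · filter_upwards [self_mem_nhdsWithin] with t ht
    simpa using ht.ne

/-- The factor `t - l₀` is harmless here, and on the left of `l₀` it absorbs the change of sign, so
both one-sided conditions take the same form. The interval on which the resolvent exists comes from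
`l₀` being isolated. -/
theorem resolventEventuallyStronglyPos_iff (hev : ∀ᶠ z in 𝓝[≠] (l₀ : ℂ), z ∈ resolventSet A) :
    ResolventEventuallyStronglyPos A u l₀ ↔ ∀ f : Complexification X, 0 < f →
      ∀ᶠ t : ℝ in 𝓝[>] l₀, StronglyPos u ((t - l₀) • resolvent A (t : ℂ) f) := by
  constructor
  · rintro ⟨l₂, hl₂, -, h⟩ f hf
    obtain ⟨l₁, hl₁, h⟩ := h f hf
    filter_upwards [Ioc_mem_nhdsGT hl₁.1] with t ht
    exact (h t ht).smul (sub_pos.2 ht.1)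
  · intro h
    have hev' := tendsto_ofReal_nhdsGT.eventually hev
    obtain ⟨l₂, hl₂, hsub⟩ := mem_nhdsGT_iff_exists_Ioc_subset.1 hev'
    refine ⟨l₂, hl₂, hsub, fun f hf => ?_⟩
    obtain ⟨l₁, hl₁, hsub₁⟩ := mem_nhdsGT_iff_exists_Ioc_subset.1 (h f hf)
    refine ⟨min l₁ l₂, ⟨lt_min hl₁ hl₂, min_le_right _ _⟩, fun t ht => ?_⟩
    have h1 : StronglyPos u ((t - l₀) • resolvent A (t : ℂ) f) :=
      hsub₁ ⟨ht.1, ht.2.trans (min_le_left _ _)⟩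
    have ht0 := sub_pos.2 ht.1
    simpa [smul_smul, inv_mul_cancel₀ ht0.ne'] using h1.smul (inv_pos.2 ht0)

theorem resolventEventuallyStronglyNeg_iff (hev : ∀ᶠ z in 𝓝[≠] (l₀ : ℂ), z ∈ resolventSet A) :
    ResolventEventuallyStronglyNeg A u l₀ ↔ ∀ f : Complexification X, 0 < f →
      ∀ᶠ t : ℝ in 𝓝[<] l₀, StronglyPos u ((t - l₀) • resolvent A (t : ℂ) f) := by
  constructor
  · rintro ⟨l₂, hl₂, -, h⟩ f hf
    obtain ⟨l₁, hl₁, h⟩ := h f hf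
    filter_upwards [Ico_mem_nhdsLT hl₁.2] with t ht
    have h1 := StronglyPos.smul (h t ht) (sub_pos.2 ht.2)
    rwa [smul_neg, ← neg_smul, neg_sub] at h1
  · intro h
    have hev' := tendsto_ofReal_nhdsLT.eventually hev
    obtain ⟨l₂, hl₂, hsub⟩ := mem_nhdsLT_iff_exists_Ico_subset.1 hev'
    refine ⟨l₂, hl₂, hsub, fun f hf => ?_⟩
    obtain ⟨l₁, hl₁, hsub₁⟩ := mem_nhdsLT_iff_exists_Ico_subset.1 (h f hf)
    refine ⟨max l₁ l₂, ⟨le_max_right _ _, max_lt hl₁ hl₂⟩, fun t ht => ?_⟩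
    have h1 : StronglyPos u ((t - l₀) • resolvent A (t : ℂ) f) :=
      hsub₁ ⟨(le_max_left _ _).trans ht.1, ht.2⟩
    have ht0 := sub_pos.2 ht.2
    have h2 := h1.smul (inv_pos.2 ht0)
    rwa [← neg_sub l₀ t, neg_smul, smul_neg, smul_smul, inv_mul_cancel₀ ht0.ne', one_smul] at h2

/-- One-sided eventual strong positivity of the resolvent gives strong positivity of the
spectral projection. -/
theorem stronglyPosOp_of_eventually_resolvent (hu : IsQuasiInterior u)
    (h_pole : IsPoleOfResolvent A (l₀ : ℂ)) (hP : IsSpectralProjection A (l₀ : ℂ) P)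
    {l : Filter ℝ} [NeBot l] (hl : Tendsto (fun t : ℝ => (t : ℂ)) l (𝓝[≠] (l₀ : ℂ)))
    {ε : ℝ} (hε : ε ≠ 0) (hsign : ∀ᶠ t in l, 0 < ε * (t - l₀))
    (h : ∀ f : Complexification X, 0 < f →
      ∀ᶠ t : ℝ in l, StronglyPos u ((t - l₀) • resolvent A (t : ℂ) f)) :
    StronglyPosOp u P := by
  obtain ⟨m, U, hU, hlim, hUR, hRU, hUU⟩ := h_pole.exists_leadingCoeff hP
  have hcoe : ∀ (t : ℝ) (B : Complexification X →L[ℂ] Complexification X)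
      (f : Complexification X), (((t : ℂ) - l₀) • B) f = (t - l₀) • B f := by
    intro t B f
    rw [smul_apply, ← Complex.ofReal_sub]
    rfl
  have hρ : ∀ᶠ t : ℝ in l, (t : ℂ) ∈ resolventSet A := hl.eventually h_pole.2.1
  -- The factor `ε ^ m` corrects the sign of `(t - l₀) ^ m` on the chosen side, so that `ε ^ m U` is
  -- a limit of positive vectors at each `f ≥ 0`.
  have key := stronglyPosOp_of_invariant hu (l := l)
    (T := fun t => ((t : ℂ) - l₀) • resolvent A (t : ℂ)) (U := ((ε : ℂ) ^ m) • U)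
    (fun f hf => by simpa only [hcoe] using h f hf) ?_ ?_ ?_ ?_
  · have hne : U * U ≠ 0 := fun h0 => key.2 (by
      rw [smul_mul_smul_comm, h0, smul_zero])
    obtain ⟨rfl, rfl⟩ := hUU hne
    simpa using key.1
  · intro f hf
    rcases hf.eq_or_lt with rfl | hf
    · simp
    have h1 : Tendsto (fun t : ℝ => (ε : ℂ) ^ m • ((t : ℂ) - l₀) ^ (m + 1) • resolvent A (t : ℂ) f)
        l (𝓝 (((ε : ℂ) ^ m • U) f)) := by
      have h2 := (((ContinuousLinearMap.apply ℂ (Complexification X) f).continuous.tendsto _).comp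
        (hlim.comp hl)).const_smul ((ε : ℂ) ^ m)
      exact h2
    refine ge_of_tendsto h1 ?_
    filter_upwards [hsign, h f hf] with t ht hpos
    have h3 : (ε : ℂ) ^ m • ((t : ℂ) - l₀) ^ (m + 1) • resolvent A (t : ℂ) f =
        ((ε * (t - l₀)) ^ m) • (t - l₀) • resolvent A (t : ℂ) f := by
      change _ = ((((ε * (t - l₀)) ^ m : ℝ)) : ℂ) • ((t - l₀ : ℝ) : ℂ) • resolvent A (t : ℂ) f
      rw [smul_smul, smul_smul, mul_pow]
      congr 1
      push_cast
      ring
    rw [h3]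
    exact smul_nonneg (pow_nonneg ht.le m) (hpos.nonneg hu.1)
  · exact smul_ne_zero (pow_ne_zero _ (by exact_mod_cast hε)) hU
  · filter_upwards [hρ] with t ht
    rw [mul_smul_comm, smul_mul_assoc, smul_comm, hUR _ ht]
  · filter_upwards [hρ] with t ht
    rw [smul_mul_assoc, mul_smul_comm, smul_comm, hRU _ ht]

theorem range_resolvent_subset (h_dom : (A.domain : Set (Complexification X)) ⊆ principalIdeal u)
    {w : ℂ} (hw : w ∈ resolventSet A) (g : Complexification X) :
    resolvent A w g ∈ principalIdeal u :=
  h_dom (resolvent_mem_domain hw g)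

/-- The eigenvector lies in `E_u` and is nonzero, which excludes `u = 0`. -/
theorem StronglyPosOp.rank_one (hu : 0 ≤ u)
    (h_eig : IsEigenvalue A (l₀ : ℂ)) (h_pole : IsPoleOfResolvent A (l₀ : ℂ))
    (hP : IsSpectralProjection A (l₀ : ℂ) P)
    (h_dom : (A.domain : Set (Complexification X)) ⊆ principalIdeal u)
    (hpos : StronglyPosOp u P) (f : Complexification X) : ∃ α : ℂ, P f = α • P u := by
  refine hpos.exists_eq_smul hu ?_ (hP.mul_self h_pole) (fun g => h_dom (hP.mem_domain g)) f
  rintro rfl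
  obtain ⟨e, he, -⟩ := h_eig
  obtain ⟨c, -, hc⟩ := h_dom e.2
  rw [smul_zero] at hc
  refine he (norm_le_zero_iff.1 ?_)
  have h1 : modulus (e : Complexification X) = 0 := le_antisymm hc.1 (modulus_nonneg _)
  rw [norm_def, h1, norm_zero]

/-- Strong positivity of the spectral projection gives eventual strong positivity of
`(t - l₀) R(t, A)` as `t → l₀`. -/
theorem StronglyPosOp.eventually_resolvent (hu : 0 ≤ u) (hA_real : IsRealOperator A)
    (h_eig : IsEigenvalue A (l₀ : ℂ)) (h_pole : IsPoleOfResolvent A (l₀ : ℂ))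
    (hP : IsSpectralProjection A (l₀ : ℂ) P)
    (h_dom : (A.domain : Set (Complexification X)) ⊆ principalIdeal u)
    (hpos : StronglyPosOp u P)
    {l : Filter ℝ} (hl : Tendsto (fun t : ℝ => (t : ℂ)) l (𝓝[≠] (l₀ : ℂ)))
    (f : Complexification X) (hf : 0 < f) :
    ∀ᶠ t : ℝ in l, StronglyPos u ((t - l₀) • resolvent A (t : ℂ) f) := by
  obtain ⟨hlim, -, hPR, hRP⟩ := h_pole.simple hP h_eig (hpos.rank_one hu h_eig h_pole hP h_dom)
  obtain ⟨-, -, -, -, w, hw, -⟩ := hP.exists_laurentCoeff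
  have hρ : ∀ᶠ t : ℝ in l, (t : ℂ) ∈ resolventSet A := hl.eventually h_pole.2.1
  -- Chosen from `R(t) = R(w) (1 + (w - t) R(t))` so that `R(w) g(t) = (t - l₀) R(t) f`. It
  -- converges in norm to `(w - l₀) P f`, which `R(w)` sends to `P f`.
  set g : ℝ → Complexification X := fun t =>
    ((t : ℂ) - l₀) • f + (w - t) • (((t : ℂ) - l₀) • resolvent A (t : ℂ)) f with hg
  have hlim' := hlim.comp hl
  have ht0 : Tendsto (fun t : ℝ => (t : ℂ)) l (𝓝 (l₀ : ℂ)) := hl.mono_right nhdsWithin_le_nhds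
  have hglim : Tendsto g l (𝓝 ((w - l₀) • P f)) := by
    have h1 : Tendsto (fun t : ℝ => ((t : ℂ) - l₀) • f) l (𝓝 0) := by
      simpa using (ht0.sub_const (l₀ : ℂ)).smul_const f
    have h2 := (ht0.const_sub w).smul
      (((ContinuousLinearMap.apply ℂ (Complexification X) f).continuous.tendsto _).comp hlim')
    have h3 := h1.add h2
    rwa [zero_add] at h3
  have hTg : ∀ t : ℝ, (t : ℂ) ∈ resolventSet A →
      resolvent A w (g t) = (t - l₀) • resolvent A (t : ℂ) f := by
    intro t ht
    have h1 := congrArg (fun T : Complexification X →L[ℂ] Complexification X =>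
      ((t : ℂ) - l₀) • T f) (resolvent_mul_one_add hw ht)
    have h2 : (t - l₀) • resolvent A (t : ℂ) f = ((t : ℂ) - l₀) • resolvent A (t : ℂ) f := by
      rw [← Complex.ofReal_sub]
      rfl
    rw [h2, ← h1]
    simp only [hg, mul_apply_eq_comp, add_apply, smul_apply, one_apply_eq_self, map_add, map_smul,
      smul_add]
    rw [smul_comm]
  have hTg0 : resolvent A w ((w - l₀) • P f) = P f := by
    have := congrArg (fun T : Complexification X →L[ℂ] Complexification X => T f) (hRP w hw)
    rwa [map_smul]
  have hmain := eventually_stronglyPos_of_tendsto hu (range_resolvent_subset h_dom hw) hglim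
    (by rw [hTg0]; exact hpos f hf) (by
      filter_upwards [hρ] with t ht
      rw [hTg t ht, real_smul_im, im_resolvent_eq_zero hA_real ht hf.le.2.symm, smul_zero])
  filter_upwards [hmain, hρ] with t h1 h2
  rwa [hTg t h2] at h1

/-- Strong positivity of the spectral projection of the spectral bound gives eventual strong
positivity of the powers of the resolvent. -/
theorem StronglyPosOp.eventually_pow (hu : 0 ≤ u) (hA_real : IsRealOperator A)
    (h_eig : IsEigenvalue A (l₀ : ℂ)) (h_pole : IsPoleOfResolvent A (l₀ : ℂ))
    (hP : IsSpectralProjection A (l₀ : ℂ) P)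
    (h_dom : (A.domain : Set (Complexification X)) ⊆ principalIdeal u)
    (hpos : StronglyPosOp u P) (hs : (l₀ : EReal) = spectralBound A) {l : ℝ}
    (hl : spectralBound A < (l : EReal)) :
    EventuallyStronglyPosOp u (resolvent A (l : ℂ)) := by
  obtain ⟨-, hL, hPR, hRP⟩ := h_pole.simple hP h_eig (hpos.rank_one hu h_eig h_pole hP h_dom)
  have hl0 : l₀ < l := by
    rw [← hs] at hl
    exact_mod_cast hl
  have hlρ : (l : ℂ) ∈ resolventSet A := mem_resolventSet_of_spectralBound_lt (by simpa using hl)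
  have hlim := tendsto_pow_smul_resolvent hL hPR hRP (hP.mul_self h_pole) h_pole.2.1 hlρ
    (by exact_mod_cast hl0.ne') ?_
  · intro f hf
    set T := ((l : ℂ) - l₀) • resolvent A (l : ℂ) with hT
    have hTpow : ∀ (n : ℕ) (g : Complexification X),
        (T ^ n) g = ((l - l₀) ^ n) • (resolvent A (l : ℂ) ^ n) g := by
      intro n g
      rw [hT, smul_pow, smul_apply, ← Complex.ofReal_sub, ← Complex.ofReal_pow]
      rfl
    have hTim : ∀ n : ℕ, ((T ^ n) f).im = 0 := by
      intro n
      rw [hTpow, real_smul_im]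
      have : ((resolvent A (l : ℂ) ^ n) f).im = 0 := by
        induction n with
        | zero => exact hf.le.2.symm
        | succ n ih =>
          rw [pow_succ', mul_apply_eq_comp]
          exact im_resolvent_eq_zero hA_real hlρ ih
      rw [this, smul_zero]
    have hTP : T (P f) = P f := by
      have := congrArg (fun T : Complexification X →L[ℂ] Complexification X => T f) (hRP l hlρ)
      exact this
    have hsucc : ∀ n : ℕ, T ((T ^ n) f) = (T ^ (n + 1)) f := by
      intro n
      rw [pow_succ', mul_apply_eq_comp]
    -- One factor `T` is kept outside as the map into `E_u`, while `T ^ n f` converges to `P f`;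
    -- hence the shift by one in the threshold.
    have hmain := eventually_stronglyPos_of_tendsto hu (T := T) (g := fun n : ℕ => (T ^ n) f)
      (g₀ := P f) (l := atTop) (fun g => ?_) ?_ ?_ ?_
    · obtain ⟨n₀, hn₀⟩ := eventually_atTop.1 hmain
      refine ⟨n₀ + 1, fun n hn => ?_⟩
      obtain ⟨k, rfl⟩ : ∃ k, n = k + 1 := ⟨n - 1, by omega⟩
      have h1 := hn₀ k (by omega)
      rw [hsucc, hTpow] at h1
      have hp : 0 < (l - l₀) ^ (k + 1) := pow_pos (sub_pos.2 hl0) _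
      have h2 := h1.smul (inv_pos.2 hp)
      rwa [smul_smul, inv_mul_cancel₀ hp.ne', one_smul] at h2
    · rw [hT, smul_apply, ← map_smul]
      exact range_resolvent_subset h_dom hlρ _
    · exact ((ContinuousLinearMap.apply ℂ (Complexification X) f).continuous.tendsto _).comp hlim
    · rw [hTP]
      exact hpos f hf
    · exact Eventually.of_forall fun n => by rw [hsucc, hTim]
  · intro c hc hne
    -- The closed disc about `l` of radius `l - l₀` meets the half-plane `Re ≤ l₀` only at `l₀`, the
    -- excluded point.
    set d : ℂ := c * ((l : ℂ) - l₀) with hd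
    have hnorm : ‖d‖ ≤ l - l₀ := by
      have h1 : ‖((l : ℂ) - l₀)‖ = l - l₀ := by
        rw [← Complex.ofReal_sub, Complex.norm_real, Real.norm_of_nonneg (sub_pos.2 hl0).le]
      rw [hd, norm_mul, h1]
      exact mul_le_of_le_one_left (sub_pos.2 hl0).le hc
    refine mem_resolventSet_of_spectralBound_lt ?_
    rw [← hs, EReal.coe_lt_coe_iff]
    have hre : d.re ≤ ‖d‖ := Complex.re_le_norm d
    simp only [Complex.sub_re, Complex.ofReal_re]
    by_contra hge
    have hdre : d.re = ‖d‖ := by linarith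
    have hdl : ‖d‖ = l - l₀ := by linarith
    have hdim : d.im = 0 := by
      have h1 := Complex.sq_norm d
      rw [Complex.normSq_apply, ← hdre] at h1
      nlinarith
    refine hne ?_
    apply Complex.ext
    · simp [hdre, hdl]
    · simp [hdim]

/-- Eventual strong positivity of the powers of the resolvent to the right of the spectral bound
gives strong positivity of the spectral projection. -/
theorem EventuallyStronglyPosOp.stronglyPosOp (hu : IsQuasiInterior u)
    (h_pole : IsPoleOfResolvent A (l₀ : ℂ)) (hP : IsSpectralProjection A (l₀ : ℂ) P)
    (hs : (l₀ : EReal) = spectralBound A) {l : ℝ} (hl : spectralBound A < (l : EReal))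
    (h : EventuallyStronglyPosOp u (resolvent A (l : ℂ))) : StronglyPosOp u P := by
  obtain ⟨m, U, hU, hlim, hUR, hRU, hUU⟩ := h_pole.exists_leadingCoeff hP
  have hl0 : l₀ < l := by
    rw [← hs] at hl
    exact_mod_cast hl
  have hρ : ∀ z : ℂ, l₀ < z.re → z ∈ resolventSet A := fun z hz =>
    mem_resolventSet_of_spectralBound_lt (by rw [← hs]; exact_mod_cast hz)
  have hlρ : (l : ℂ) ∈ resolventSet A := hρ _ (by simpa using hl0)
  set R := resolvent A (l : ℂ) with hR
  have hcoe : ∀ (n : ℕ) (f : Complexification X),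
      ((((l : ℂ) - l₀) • R) ^ n) f = ((l - l₀) ^ n) • (R ^ n) f := by
    intro n f
    rw [smul_pow, smul_apply, ← Complex.ofReal_sub, ← Complex.ofReal_pow]
    rfl
  have key := stronglyPosOp_of_invariant hu (l := atTop)
    (T := fun n : ℕ => (((l : ℂ) - l₀) • R) ^ n) (U := U) ?_ ?_ hU ?_ ?_
  · obtain ⟨rfl, rfl⟩ := hUU key.2
    exact key.1
  · intro f hf
    obtain ⟨n₀, hn₀⟩ := h f hf
    filter_upwards [eventually_ge_atTop n₀] with n hn
    rw [hcoe]
    exact (hn₀ n hn).smul (pow_pos (sub_pos.2 hl0) n)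
  · intro f hf
    rcases hf.eq_or_lt with rfl | hf
    · simp
    obtain ⟨n₀, hn₀⟩ := h f hf
    -- The first `n₀` terms of the Neumann expansion of `R(t) f` about `l`, whose sign is unknown;
    -- all later terms are nonnegative. `Q` is continuous at `l₀`, so multiplication by `(t - l₀) ^
    -- (m + 1)` removes it in the limit.
    set Q : ℝ → Complexification X := fun t =>
      ∑ k ∈ Finset.range n₀, ((l - t) ^ k) • (R ^ (k + 1)) f with hQ
    have hle : ∀ t ∈ Set.Ioo l₀ l, Q t ≤ resolvent A (t : ℂ) f := by
      intro t ht
      have htρ : (t : ℂ) ∈ resolventSet A := hρ _ (by simpa using ht.1)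
      have hid : ∀ n : ℕ, resolvent A (t : ℂ) f =
          ∑ k ∈ Finset.range n, ((l - t) ^ k) • (R ^ (k + 1)) f +
            ((((l : ℂ) - t) • R) ^ n) (resolvent A (t : ℂ) f) := by
        intro n
        induction n with
        | zero => simp
        | succ n ih =>
          have h1 := one_add_mul_resolvent htρ hlρ
          rw [← hR] at h1
          have h2 : resolvent A (t : ℂ) f = R f + (((l : ℂ) - t) • R) (resolvent A (t : ℂ) f) := by
            have h4 := congrArg (fun T : Complexification X →L[ℂ] Complexification X => T f) h1
            simp only [mul_apply_eq_comp, add_apply, smul_apply, one_apply_eq_self] at h4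
            rw [← h4, smul_apply]
            module
          have h3 : ((((l : ℂ) - t) • R) ^ n) (R f) = ((l - t) ^ n) • (R ^ (n + 1)) f := by
            rw [smul_pow, smul_apply, ← Complex.ofReal_sub, ← Complex.ofReal_pow, pow_succ]
            rfl
          rw [Finset.sum_range_succ, add_assoc, ← h3, pow_succ, mul_apply_eq_comp, ← map_add, ← h2]
          exact ih
      -- For `‖c‖ ≤ 1` the point `l - c (l - t)` has real part at least `t > l₀`, so the remainder
      -- vanishes for every `t` in `(l₀, l)`, not only near `l`.
      have hpow : Tendsto (fun n : ℕ => (((l : ℂ) - t) • R) ^ n) atTop (𝓝 0) := by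
        refine tendsto_pow_of_isUnit_one_sub_smul _ fun c hc => ?_
        rw [smul_smul]
        refine isUnit_one_sub_smul_resolvent hlρ (hρ _ ?_)
        have h1 : (c * ((l : ℂ) - t)).re ≤ l - t := by
          refine (Complex.re_le_norm _).trans ?_
          rw [norm_mul, ← Complex.ofReal_sub, Complex.norm_real,
            Real.norm_of_nonneg (sub_pos.2 ht.2).le]
          exact mul_le_of_le_one_left (sub_pos.2 ht.2).le hc
        rw [Complex.sub_re, Complex.ofReal_re]
        linarith [ht.1]
      have hlim2 : Tendsto (fun n : ℕ => Q t +
          ((((l : ℂ) - t) • R) ^ n) (resolvent A (t : ℂ) f)) atTop (𝓝 (Q t)) := by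
        have h1 := ((ContinuousLinearMap.apply ℂ (Complexification X)
          (resolvent A (t : ℂ) f)).continuous.tendsto _).comp hpow
        simpa using h1.const_add (Q t)
      refine le_of_tendsto hlim2 ?_
      filter_upwards [eventually_ge_atTop n₀] with n hn
      refine le_of_le_of_eq ?_ (hid n).symm
      refine add_le_add ?_ le_rfl
      refine Finset.sum_le_sum_of_subset_of_nonneg (Finset.range_mono hn) fun k _ hk => ?_
      rw [Finset.mem_range, not_lt] at hk
      exact smul_nonneg (pow_nonneg (sub_pos.2 ht.2).le k)
        ((hn₀ (k + 1) (by omega)).nonneg hu.1)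
    have h1 : Tendsto (fun t : ℝ => ((t - l₀) ^ (m + 1)) • resolvent A (t : ℂ) f)
        (𝓝[>] l₀) (𝓝 (U f)) := by
      have h2 := (((ContinuousLinearMap.apply ℂ (Complexification X) f).continuous.tendsto _).comp
        (hlim.comp tendsto_ofReal_nhdsGT))
      refine h2.congr fun t => ?_
      change ((t : ℂ) - l₀) ^ (m + 1) • resolvent A (t : ℂ) f = _
      rw [← Complex.ofReal_sub, ← Complex.ofReal_pow]
      rfl
    have h2 : Tendsto (fun t : ℝ => ((t - l₀) ^ (m + 1)) • Q t) (𝓝[>] l₀) (𝓝 0) := by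
      have hcont : Continuous fun t : ℝ => ((t - l₀) ^ (m + 1)) • Q t := by
        simp only [hQ]
        fun_prop
      simpa using (hcont.tendsto l₀).mono_left nhdsWithin_le_nhds
    refine le_of_tendsto_of_tendsto h2 h1 ?_
    filter_upwards [Ioo_mem_nhdsGT hl0] with t ht
    exact smul_le_smul_of_nonneg_left (hle t ht) (pow_nonneg (sub_pos.2 ht.1).le _)
  · refine Eventually.of_forall fun n => ?_
    induction n with
    | zero => simp
    | succ n ih => rw [pow_succ, ← mul_assoc, ih, mul_smul_comm, hUR _ hlρ]
  · refine Eventually.of_forall fun n => ?_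
    induction n with
    | zero => simp
    | succ n ih => rw [pow_succ', mul_assoc, ih, smul_mul_assoc, hRU _ hlρ]

end EventualPositivity

theorem mainTheorem3 {X : Type*} [NormedAddCommGroup X] [NormedSpace ℝ X] [Lattice X]
    [IsOrderedAddMonoid X] [IsOrderedModule ℝ X] [HasSolidNorm X] [CompleteSpace X]
    (A : Complexification X →ₗ.[ℂ] Complexification X)
    (hA_closed : A.IsClosed) (hA_dense : Dense (A.domain : Set (Complexification X)))
    (hA_real : EventualPositivity.IsRealOperator A)
    (l₀ : ℝ) (h_eig : EventualPositivity.IsEigenvalue A (l₀ : ℂ))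
    (h_pole : EventualPositivity.IsPoleOfResolvent A (l₀ : ℂ))
    (P : Complexification X →L[ℂ] Complexification X)
    (hP : EventualPositivity.IsSpectralProjection A (l₀ : ℂ) P)
    (u : Complexification X) (hu : 0 ≤ u)
    (h_dom : (A.domain : Set (Complexification X)) ⊆ EventualPositivity.principalIdeal u) :
    EventualPositivity.IsQuasiInterior u ∧
    List.TFAE [
      EventualPositivity.StronglyPosOp u P,
      EventualPositivity.ResolventEventuallyStronglyPos A u l₀,
      EventualPositivity.ResolventEventuallyStronglyNeg A u l₀] ∧
    ((l₀ : EReal) = EventualPositivity.spectralBound A →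
      List.TFAE [
        EventualPositivity.StronglyPosOp u P,
        EventualPositivity.ResolventEventuallyStronglyPos A u l₀,
        EventualPositivity.ResolventEventuallyStronglyNeg A u l₀,
        ∃ l : ℝ, EventualPositivity.spectralBound A < (l : EReal) ∧
          EventualPositivity.EventuallyStronglyPosOp u
            (EventualPositivity.resolvent A (l : ℂ)),
        ∀ l : ℝ, EventualPositivity.spectralBound A < (l : EReal) →
          EventualPositivity.EventuallyStronglyPosOp u
            (EventualPositivity.resolvent A (l : ℂ))]) := by
  have hq : EventualPositivity.IsQuasiInterior u := ⟨hu, hA_dense.mono h_dom⟩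
  have hev := h_pole.2.1
  have h12 : EventualPositivity.StronglyPosOp u P ↔
      EventualPositivity.ResolventEventuallyStronglyPos A u l₀ := by
    rw [EventualPositivity.resolventEventuallyStronglyPos_iff hev]
    refine ⟨fun h => h.eventually_resolvent hu hA_real h_eig h_pole hP h_dom
      EventualPositivity.tendsto_ofReal_nhdsGT, fun h => ?_⟩
    refine EventualPositivity.stronglyPosOp_of_eventually_resolvent hq h_pole hP
      EventualPositivity.tendsto_ofReal_nhdsGT (ε := 1) one_ne_zero ?_ h
    filter_upwards [self_mem_nhdsWithin] with t ht
    simpa using ht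
  have h13 : EventualPositivity.StronglyPosOp u P ↔
      EventualPositivity.ResolventEventuallyStronglyNeg A u l₀ := by
    rw [EventualPositivity.resolventEventuallyStronglyNeg_iff hev]
    refine ⟨fun h => h.eventually_resolvent hu hA_real h_eig h_pole hP h_dom
      EventualPositivity.tendsto_ofReal_nhdsLT, fun h => ?_⟩
    refine EventualPositivity.stronglyPosOp_of_eventually_resolvent hq h_pole hP
      EventualPositivity.tendsto_ofReal_nhdsLT (ε := -1) (by norm_num) ?_ h
    filter_upwards [self_mem_nhdsWithin] with t ht
    simpa using ht
  refine ⟨hq, ?_, fun hs => ?_⟩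
  · tfae_have 1 ↔ 2 := h12
    tfae_have 1 ↔ 3 := h13
    tfae_finish
  · tfae_have 1 ↔ 2 := h12
    tfae_have 1 ↔ 3 := h13
    tfae_have 1 → 5 := fun h l hl => h.eventually_pow hu hA_real h_eig h_pole hP h_dom hs hl
    tfae_have 5 → 4 := fun h => ⟨l₀ + 1, by
      rw [← hs, EReal.coe_lt_coe_iff]
      exact lt_add_one l₀, h _ (by
      rw [← hs, EReal.coe_lt_coe_iff]
      exact lt_add_one l₀)⟩
    tfae_have 4 → 1 := fun ⟨l, hl, h⟩ => h.stronglyPosOp hq h_pole hP hs hl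
    tfae_finish
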